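/- **Setting.** Let $n\ge 1$, let $\Omega\subset\mathbb R^n$ be a bounded open set with Lipschitz boundary, let $a\in[0,1)$, and let $\phi:\mathbb R\to[0,\infty)$ be continuous, even, nondecreasing on $[0,\infty)$, with $\phi^{-1}(0)=\{0\}$ and $$\lim_{p\to+\infty}\frac{\phi(\lambda p)}{\phi(p)}=\lambda^a\qquad\text{for every }\lambda>0 .$$ For $A\subseteq\Omega$ open and $\nu\in(0,1]$ let $F_\nu(\cdot,A):L^2(A)\to[0,+\infty]$, $$F_\nu(u,A)=\frac12\int_A\Big[\nu^3|\nabla^2u|^2+\frac{1}{\nu\,\phi(1/\nu)}\,\phi(|\nabla u|)\Big]dx\ \text{ if }u\in H^2(A),\qquad F_\nu(u,A)=+\infty\ \text{ otherwise,}$$ where $|M|=\max\{|\langle M\xi,\xi\rangle|:|\xi|\le1\}$ for symmetric matrices $M$, and let $$\Gamma\text{-}\limsup_{\nu\to0^+}F_\nu(u,A)=\inf\Big\{\limsup_{\nu\to0^+}F_\nu(u_\nu,A)\;:\;u_\nu\to u\text{ in }L^2(A)\text{ as }\nu\to0^+\Big\}.$$ Let $\sigma_a=\frac12\inf\int_0^\eta\big[(\psi'')^2+|\psi'|^a\big]dx$,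 the infimum being over all $\eta>0$ and all $\psi\in H^2((0,\eta))$ with $\psi(0)=0$, $\psi(\eta)=1$, $\psi'(0)=\psi'(\eta)=0$. Let $\mathcal H^{n-1}$ be the Hausdorff measure, normalized as surface area. **Proposition 5.5.** Let $\Omega'$ be a bounded open set with $\overline\Omega\subset\Omega'$, and let $E=E'\cap\Omega$, where $E'$ is a set of finite perimeter in $\Omega'$ such that $\partial E'\cap\Omega'$ is a smooth (embedded, $C^\infty$) hypersurface. Then $$\Gamma\text{-}\limsup_{\nu\to0^+}F_\nu(s1_E,A)\ \le\ \sigma_a\,|s|^{\frac{2+a}{4-a}}\;\mathcal H^{n-1}(A\cap\partial E)$$ for all $s\in\mathbb R$ and all open $A\subseteq\Omega$ such that either $A$ has Lipschitz boundary (in particular $A=\Omega$) or $\mathcal H^{n-1}(\Omega\cap\partial A\cap\partial E')=0$. -/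

import Mathlib

open MeasureTheory Filter Topology Set
open scoped ENNReal NNReal ContDiff

noncomputable section

namespace PeronaMalik

/-- Abbreviation for `ℝⁿ` with its Euclidean norm. -/
abbrev Rn (n : ℕ) : Type := EuclideanSpace ℝ (Fin n)

/-! ### The nonlinearity -/

/-- The standing assumptions on the nonlinearity `φ : ℝ → [0, ∞)` with growth exponent `a`:
continuous, even, nondecreasing on `[0, ∞)`, vanishing exactly at `0`, and such that
`φ (l p) / φ p → l ^ a` as `p → +∞`, for every `l > 0`, where `a ∈ [0, 1)`. -/
structure IsAdmissible (φ : ℝ → ℝ) (a : ℝ) : Prop where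
  exponent_mem : a ∈ Ico (0 : ℝ) 1
  nonneg : ∀ p, 0 ≤ φ p
  continuous : Continuous φ
  even : ∀ p, φ (-p) = φ p
  monotoneOn : MonotoneOn φ (Ici 0)
  eq_zero_iff : ∀ p, φ p = 0 ↔ p = 0
  growth : ∀ l : ℝ, 0 < l → Tendsto (fun p => φ (l * p) / φ p) atTop (𝓝 (l ^ a))

/-! ### Weak derivatives, `H²`, and the functionals -/

/-- `D` is the weak (Fréchet) derivative of `u` in the open set `A`:
`∫_A (∂_w ζ) u = - ∫_A ζ (D w)` for all `ζ ∈ C_c^∞(A)` and all directions `w`.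
It is meant for `u`, `D` locally integrable in `A`. -/
def HasWeakFDeriv {n : ℕ} {F : Type*} [NormedAddCommGroup F] [NormedSpace ℝ F]
    (A : Set (Rn n)) (u : Rn n → F) (D : Rn n → Rn n →L[ℝ] F) : Prop :=
  ∀ ζ : Rn n → ℝ, ContDiff ℝ ∞ ζ → HasCompactSupport ζ → tsupport ζ ⊆ A →
    ∀ w : Rn n, ∫ x in A, fderiv ℝ ζ x w • u x = - ∫ x in A, ζ x • D x w

/-- `u ∈ H²(A)`, with weak gradient `Du` (a covector field) and weak Hessian `D2u`
(a field of bilinear forms). -/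
structure IsH2 {n : ℕ} (A : Set (Rn n)) (u : Rn n → ℝ)
    (Du : Rn n → Rn n →L[ℝ] ℝ) (D2u : Rn n → Rn n →L[ℝ] Rn n →L[ℝ] ℝ) : Prop where
  memLp : MemLp u 2 (volume.restrict A)
  memLp_fderiv : MemLp Du 2 (volume.restrict A)
  memLp_hessian : MemLp D2u 2 (volume.restrict A)
  weak_fderiv : HasWeakFDeriv A u Du
  weak_hessian : HasWeakFDeriv A Du D2u

/-- The localized functional
`F_ν(u, A) = 1/2 ∫_A [ν³ |∇²u|² + φ(|∇u|) / (ν φ(1/ν))] dx` if `u ∈ H²(A)`, and `+∞` otherwise in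
`L²(A)`. The weak derivatives of `u ∈ H²(A)` are unique almost everywhere, so that the infimum
below is over values that all agree; it is `⊤` when `u ∉ H²(A)`. The operator norm of the symmetric
bilinear form `∇²u(x)` is `max {|⟨∇²u(x) ξ, ξ⟩| : |ξ| ≤ 1}`. -/
def energy {n : ℕ} (φ : ℝ → ℝ) (A : Set (Rn n)) (ν : ℝ)
    (u : Lp ℝ 2 (volume.restrict A)) : ℝ≥0∞ :=
  ⨅ (Du : Rn n → Rn n →L[ℝ] ℝ) (D2u : Rn n → Rn n →L[ℝ] Rn n →L[ℝ] ℝ) (_ : IsH2 A u Du D2u),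
    (1 / 2) * ∫⁻ x in A,
      ENNReal.ofReal (ν ^ 3 * ‖D2u x‖ ^ 2 + 1 / (ν * φ (1 / ν)) * φ ‖Du x‖)

/-- The `Γ-limsup`, as `ν → 0⁺`, of a family `(F_ν)` of functionals on (the first countable
space) `X`:
`inf { limsup_{ν → 0⁺} F_ν(v_ν) : v_ν → u in X as ν → 0⁺ }`. -/
def gammaLimsup {X : Type*} [TopologicalSpace X] (F : ℝ → X → ℝ≥0∞) (u : X) : ℝ≥0∞ :=
  ⨅ (v : ℝ → X) (_ : Tendsto v (𝓝[>] 0) (𝓝 u)), limsup (fun ν => F ν (v ν)) (𝓝[>] 0)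

/-! ### The constant `σ_a` -/

/-- `ψ` (with first and second derivatives `p` and `g`) belongs to
`Y_η(s) = {ψ ∈ H²((0, η)) : ψ(0) = 0, ψ(η) = s, ψ'(0) = ψ'(η) = 0}`.
A function of `H²((0, η))` is identified with its representative in `C¹([0, η])`, whose derivative
is a primitive of a function of `L²((0, η))`. -/
structure IsProfile (η s : ℝ) (ψ p g : ℝ → ℝ) : Prop where
  memLp : MemLp g 2 (volume.restrict (Ioo 0 η))
  deriv_eq : ∀ t ∈ Icc 0 η, p t = p 0 + ∫ τ in (0 : ℝ)..t, g τ
  value_eq : ∀ t ∈ Icc 0 η, ψ t = ψ 0 + ∫ τ in (0 : ℝ)..t, p τ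
  value_left : ψ 0 = 0
  value_right : ψ η = s
  deriv_left : p 0 = 0
  deriv_right : p η = 0

/-- `e_a(s) = 1/2 inf { ∫_0^η [(ψ'')² + |ψ'|^a] dx : η > 0, ψ ∈ Y_η(s) }`. -/
def profileEnergy (a s : ℝ) : ℝ≥0∞ :=
  (1 / 2) * ⨅ (η : ℝ) (_ : 0 < η) (ψ : ℝ → ℝ) (p : ℝ → ℝ) (g : ℝ → ℝ) (_ : IsProfile η s ψ p g),
    ∫⁻ t in Ioo 0 η, ENNReal.ofReal (g t ^ 2 + |p t| ^ a)

/-- The constant `σ_a` in the identity `e_a(s) = σ_a s^((2 + a) / (4 - a))`, `s ≥ 0`, that is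
`σ_a = e_a(1)`. -/
def sigma (a : ℝ) : ℝ≥0∞ := profileEnergy a 1

/-! ### Lipschitz sets, smooth hypersurfaces, finite perimeter -/

/-- An open set with Lipschitz boundary: near every boundary point `x` the set is, in suitable
orthonormal coordinates with last axis `e`, the region above the graph of a Lipschitz function `g`
of the other coordinates (`g` is constant along `e`). -/
def IsOpenLipschitz {n : ℕ} (Ω : Set (Rn n)) : Prop :=
  IsOpen Ω ∧ ∀ x ∈ frontier Ω, ∃ (e : Rn n) (g : Rn n → ℝ) (K : ℝ≥0) (U : Set (Rn n)),
    ‖e‖ = 1 ∧ LipschitzWith K g ∧ (∀ (y : Rn n) (t : ℝ), g (y + t • e) = g y) ∧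
    IsOpen U ∧ x ∈ U ∧ ∀ y ∈ U, (y ∈ Ω ↔ g y < inner ℝ y e)

/-- `M ∩ Ω'` is a smooth (embedded, `C^∞`) hypersurface in the open set `Ω'`: near each of its
points, `M` is the zero set of a smooth function without critical points. -/
def IsSmoothHypersurfaceIn {n : ℕ} (Ω' M : Set (Rn n)) : Prop :=
  ∀ x ∈ M ∩ Ω', ∃ (U : Set (Rn n)) (f : Rn n → ℝ),
    IsOpen U ∧ x ∈ U ∧ ContDiffOn ℝ ∞ f U ∧ (∀ y ∈ U, fderiv ℝ f y ≠ 0) ∧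
    M ∩ U = {y ∈ U | f y = 0}

/-- `S` has finite perimeter in the open set `Ω'`: it is Lebesgue measurable in `Ω'`, and
`∫_{S ∩ Ω'} div T` is bounded over `T ∈ C_c^1(Ω'; ℝⁿ)` with `|T| ≤ 1`. -/
def HasFinitePerimeterIn {n : ℕ} (Ω' S : Set (Rn n)) : Prop :=
  NullMeasurableSet (S ∩ Ω') volume ∧
  ∃ C : ℝ, ∀ T : Rn n → Rn n, ContDiff ℝ 1 T → HasCompactSupport T → tsupport T ⊆ Ω' →
    (∀ x, ‖T x‖ ≤ 1) →
    ∫ x in S ∩ Ω', ∑ i : Fin n, fderiv ℝ T x (EuclideanSpace.single i 1) i ≤ C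

end PeronaMalik

end

/-! The competitors are `P (d' / ν)`, where `P` is a nearly optimal one-dimensional transition from
`0` to `s` and `d'` is a smooth function, of gradient close to one in norm at its zeros, that
vanishes on a slightly displaced copy of the interface. In the layer `0 < d' < ν η` the Hessian is
`ν⁻² P'' ∇d' ⊗ ∇d'` up to lower order and the gradient is `ν⁻¹ P' ∇d'`. So the two terms of the
energy density become `ν⁻¹ (P'')²` and, by the growth condition, at most about `ν⁻¹ |P'|^a`. The
layer has thickness of order `ν`, and integration across it gives the profile energy times the area
of the interface. Rescaling a profile from height `1` to height `s` produces the power of `|s|`.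

Four ingredients carry this. (1) Profiles: an `H²` profile is replaced by a `C²` one through a short
moving average, at small cost (`IsProfile.exists_smoothProfile`, `exists_smoothProfile_lt`). (2)
Layers: `layerBound_of_isCompact` is a one-sided coarea estimate. Near a regular point the level
sets are straightened by a map whose derivative is the identity at that point, so that Fubini
applies with little loss. (3) Defining function: `exists_contDiff_signed` patches local equations of
the hypersurface, normalized to unit gradient at their zeros, by a partition of unity. Its sign is
tied to the interiors of the closures of `E` and `Eᶜ` rather than to `E` itself. The frontier may
contain sheets with `E`, or its complement, on both sides; these need no transition, and `d` does
not vanish there. (4) Displacement: the layer estimate sees `closure A`, while the bound should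
count only the interface inside `A`, although part of it may run along the boundary of `A`. If `B`
has Lipschitz boundary, `exists_inward_field` supplies `X` such that `y ↦ y + ε • X y` maps `closure
B` into `B`. With `d' y = d (y + ε • X y)`, the zeros of `d'` in `closure A` are sent to points of
the interface in `B` close to `A`, with areas distorted by a factor tending to `1`.

Letting `ε → 0` gives the bound with the area of `closure A ∩ frontier E ∩ B`. The theorem follows
with `B = A` or `B = Ω`. -/

namespace PeronaMalik

/-! ### Diagonal selection and the Γ-limsup -/

/-- Diagonal selection: if every property of a decreasing sequence is eventually satisfiable, then
a single selection eventually satisfies all of them. -/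
theorem exists_selection_of_forall_eventually {α X : Type*} {l : Filter α}
    (r : α → ℕ) (hr : Tendsto r l atTop) [Nonempty X] {p : ℕ → α → X → Prop}
    (hp : ∀ k ν w, p (k + 1) ν w → p k ν w) (h : ∀ k, ∀ᶠ ν in l, ∃ w, p k ν w) :
    ∃ v : α → X, ∀ k, ∀ᶠ ν in l, p k ν (v ν) := by
  classical
  have hmono : ∀ j k, j ≤ k → ∀ ν w, p k ν w → p j ν w := by
    intro j k hjk
    induction hjk with
    | refl => exact fun _ _ h => h
    | step _ ih => exact fun ν w hw => ih ν w (hp _ ν w hw)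
  -- At `ν`, aim for the strongest satisfiable property of index at most `r ν`. Since `r` tends to
  -- infinity, the cap eventually exceeds any given `k`.
  let N : α → ℕ := fun ν => Nat.findGreatest (fun k => ∃ w, p k ν w) (r ν)
  have key : ∀ ν, ∃ w, (∃ w', p (N ν) ν w') → p (N ν) ν w := by
    intro ν
    by_cases hν : ∃ w', p (N ν) ν w'
    · exact ⟨hν.choose, fun _ => hν.choose_spec⟩
    · exact ⟨Classical.arbitrary X, fun h => absurd h hν⟩
  choose v hv using key
  refine ⟨v, fun k => ?_⟩
  filter_upwards [h k, hr.eventually_ge_atTop k] with ν hν hk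
  exact hmono k (N ν) (Nat.le_findGreatest hk hν) ν _
    (hv ν (Nat.findGreatest_spec (P := fun k => ∃ w, p k ν w) hk hν))

/-- A bound for the `Γ-limsup` from competitors that are close to the limit and have small
energy. -/
theorem gammaLimsup_le_of_forall_eventually {X : Type*} [PseudoMetricSpace X]
    {F : ℝ → X → ℝ≥0∞} {u : X} {L : ℝ≥0∞}
    (h : ∀ δ > 0, ∀ᶠ ν in 𝓝[>] (0 : ℝ), ∃ w, dist w u < δ ∧ F ν w ≤ L) :
    gammaLimsup F u ≤ L := by
  have hr : Tendsto (fun ν : ℝ => ⌊ν⁻¹⌋₊) (𝓝[>] 0) atTop :=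
    tendsto_nat_floor_atTop.comp tendsto_inv_nhdsGT_zero
  have : Nonempty X := ⟨u⟩
  obtain ⟨v, hv⟩ := exists_selection_of_forall_eventually (l := 𝓝[>] (0 : ℝ)) _ hr
    (p := fun k ν w => dist w u < 1 / ((k : ℝ) + 1) ∧ F ν w ≤ L)
    (fun k ν w hw => ⟨hw.1.trans_le (by push_cast; gcongr; linarith), hw.2⟩)
    (fun k => h _ (by positivity))
  refine (iInf₂_le v ?_).trans ?_
  · rw [Metric.tendsto_nhds]
    intro ε hε
    obtain ⟨k, hk⟩ := exists_nat_one_div_lt hε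
    filter_upwards [hv k] with ν hν using hν.1.trans hk
  · refine limsup_le_of_le (by isBoundedDefault) ?_
    filter_upwards [hv 0] with ν hν using hν.2

/-! ### Uniformity in the growth condition -/

/-- The growth condition holds as a locally uniform upper bound. -/
theorem IsAdmissible.eventually_div_le {φ : ℝ → ℝ} {a : ℝ} (hφ : IsAdmissible φ a)
    (R : ℝ) {δ : ℝ} (hδ : 0 < δ) :
    ∀ᶠ ν in 𝓝[>] (0 : ℝ), ∀ q ∈ Icc 0 R, φ (q / ν) / φ (1 / ν) ≤ q ^ a + δ := by
  have ha := hφ.exponent_mem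
  have hlim : ∀ l : ℝ, 0 < l →
      Tendsto (fun ν : ℝ => φ (l / ν) / φ (1 / ν)) (𝓝[>] 0) (𝓝 (l ^ a)) := by
    intro l hl
    have := (hφ.growth l hl).comp tendsto_inv_nhdsGT_zero
    refine this.congr fun ν => ?_
    simp [div_eq_mul_inv]
  have hcont : ContinuousOn (fun q : ℝ => q ^ a) (Icc 0 (R + 1)) := fun q _ =>
    (Real.continuousAt_rpow_const q a (by
      rcases eq_or_lt_of_le ha.1 with h | h
      · right; exact ha.1
      · right; exact ha.1)).continuousWithinAt
  have hunif := (isCompact_Icc.uniformContinuousOn_of_continuous hcont)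
  rw [Metric.uniformContinuousOn_iff] at hunif
  obtain ⟨κ, hκ, hu⟩ := hunif (δ / 2) (by positivity)
  -- A grid of mesh `1 / N`, below `κ` for the modulus of continuity and below `1` to stay in `[0, R
  -- + 1]`. Each `q` is rounded up to a positive grid point: monotonicity of `φ` then gives the
  -- upper bound, and the growth condition is only available for positive multipliers. At `q = 0`,
  -- `a = 0` only this one-sided estimate survives, since `0 ^ 0 = 1`.
  obtain ⟨N, hN⟩ := exists_nat_gt (max (2 / κ) 2)
  have hN1 : (2 : ℝ) / κ < N := (le_max_left _ _).trans_lt hN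
  have hN2 : (2 : ℝ) < N := (le_max_right _ _).trans_lt hN
  have hN0 : (0 : ℝ) < N := by linarith
  have hev : ∀ᶠ ν in 𝓝[>] (0 : ℝ), ∀ i ∈ Finset.range (⌈R * N⌉₊ + 1),
      φ ((((i : ℕ) : ℝ) + 1) / N / ν) / φ (1 / ν) < ((((i : ℕ) : ℝ) + 1) / N) ^ a + δ / 2 := by
    rw [Filter.eventually_all_finset]
    intro i _
    exact (hlim ((i + 1) / N) (by positivity)).eventually_lt_const (by linarith)
  filter_upwards [hev, self_mem_nhdsWithin] with ν hν hν0 q hq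
  have hν0 : 0 < ν := hν0
  set i := ⌊q * N⌋₊ with hi
  have hqN : 0 ≤ q * N := mul_nonneg hq.1 hN0.le
  have h1 : (i : ℝ) ≤ q * N := Nat.floor_le hqN
  have h2 : q * N < i + 1 := Nat.lt_floor_add_one _
  have hi' : i ∈ Finset.range (⌈R * N⌉₊ + 1) := by
    rw [Finset.mem_range, Nat.lt_succ_iff]
    exact (Nat.floor_le_floor (by gcongr; exact hq.2)).trans (Nat.floor_le_ceil _)
  have hb := hν i hi'
  have hle : q ≤ (i + 1) / N := by rw [le_div_iff₀ hN0]; exact h2.le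
  have hlt : ((i : ℝ) + 1) / N < q + κ := by
    rw [div_lt_iff₀ hN0]
    rw [div_lt_iff₀ hκ] at hN1
    nlinarith
  have hlt1 : ((i : ℝ) + 1) / N ≤ q + 1 := by
    rw [div_le_iff₀ hN0]
    nlinarith
  have hd := hu ((i + 1) / N) ⟨by positivity, by linarith [hq.2]⟩ q
    ⟨hq.1, by linarith [hq.2]⟩ (by rw [Real.dist_eq, abs_lt]; constructor <;> linarith)
  rw [Real.dist_eq, abs_lt] at hd
  have hm : φ (q / ν) ≤ φ ((i + 1) / N / ν) := by
    apply hφ.monotoneOn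
    · exact div_nonneg hq.1 hν0.le
    · exact div_nonneg (by positivity) hν0.le
    · gcongr
  have : φ (q / ν) / φ (1 / ν) ≤ φ ((i + 1) / N / ν) / φ (1 / ν) :=
    div_le_div_of_nonneg_right hm (hφ.nonneg _)
  linarith [hd.2]

/-! ### One-dimensional transition profiles -/

/-- A `C²` transition from `0` to `s` that is constant outside `(0, η)`. -/
structure SmoothProfile (η s : ℝ) (P : ℝ → ℝ) : Prop where
  contDiff : ContDiff ℝ 2 P
  left : ∀ t ≤ 0, P t = 0
  right : ∀ t, η ≤ t → P t = s

/-- The energy density `(P'')² + |P'|^a` of a profile. -/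
noncomputable def profileDensity (a : ℝ) (P : ℝ → ℝ) (t : ℝ) : ℝ :=
  deriv (deriv P) t ^ 2 + |deriv P t| ^ a

theorem profileDensity_nonneg (a : ℝ) (P : ℝ → ℝ) (t : ℝ) : 0 ≤ profileDensity a P t := by
  unfold profileDensity; positivity

theorem contDiff_two_of_hasDerivAt {P D₁ D₂ : ℝ → ℝ} (h1 : ∀ t, HasDerivAt P (D₁ t) t)
    (h2 : ∀ t, HasDerivAt D₁ (D₂ t) t) (h3 : Continuous D₂) : ContDiff ℝ 2 P := by
  have e1 : deriv P = D₁ := funext fun t => (h1 t).deriv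
  have e2 : deriv D₁ = D₂ := funext fun t => (h2 t).deriv
  rw [show (2 : WithTop ℕ∞) = 1 + 1 by norm_num, contDiff_succ_iff_deriv]
  refine ⟨fun t => (h1 t).differentiableAt, by simp, ?_⟩
  rw [e1, contDiff_one_iff_deriv, e2]
  exact ⟨fun t => (h2 t).differentiableAt, h3⟩

namespace SmoothProfile
variable {η s : ℝ} {P : ℝ → ℝ}

theorem contDiff_deriv (h : SmoothProfile η s P) : ContDiff ℝ 1 (deriv P) := by
  have := h.contDiff
  rw [show (2 : WithTop ℕ∞) = 1 + 1 by norm_num, contDiff_succ_iff_deriv] at this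
  exact this.2.2

theorem continuous_deriv2 (h : SmoothProfile η s P) : Continuous (deriv (deriv P)) :=
  (contDiff_one_iff_deriv.1 h.contDiff_deriv).2

theorem hasDerivAt (h : SmoothProfile η s P) (t : ℝ) : HasDerivAt P (deriv P t) t :=
  ((h.contDiff.differentiable (by norm_num)) t).hasDerivAt

theorem hasDerivAt_deriv (h : SmoothProfile η s P) (t : ℝ) :
    HasDerivAt (deriv P) (deriv (deriv P) t) t :=
  ((h.contDiff_deriv.differentiable (by norm_num)) t).hasDerivAt

/-- Local constancy settles the open half-lines; continuity of the derivative extends the conclusion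
to the two endpoints. -/
theorem deriv_eq_zero (h : SmoothProfile η s P) {t : ℝ} (ht : t ≤ 0 ∨ η ≤ t) : deriv P t = 0 := by
  have hc : Continuous (deriv P) := h.contDiff_deriv.continuous
  have hcl : IsClosed {t | deriv P t = 0} := isClosed_singleton.preimage hc
  rcases ht with ht | ht
  · have : Iio (0 : ℝ) ⊆ {t | deriv P t = 0} := fun x hx => by
      have : P =ᶠ[𝓝 x] fun _ => 0 := by
        filter_upwards [Iio_mem_nhds hx] with y hy using h.left y (le_of_lt hy)
      simpa using this.deriv_eq
    have h2 := hcl.closure_subset_iff.2 this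
    rw [closure_Iio] at h2
    exact h2 ht
  · have : Ioi η ⊆ {t | deriv P t = 0} := fun x hx => by
      have : P =ᶠ[𝓝 x] fun _ => s := by
        filter_upwards [Ioi_mem_nhds hx] with y hy using h.right y (le_of_lt hy)
      simpa using this.deriv_eq
    have h2 := hcl.closure_subset_iff.2 this
    rw [closure_Ioi] at h2
    exact h2 ht

theorem deriv2_eq_zero (h : SmoothProfile η s P) {t : ℝ} (ht : t ≤ 0 ∨ η ≤ t) :
    deriv (deriv P) t = 0 := by
  have hcl : IsClosed {t | deriv (deriv P) t = 0} := isClosed_singleton.preimage h.continuous_deriv2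
  rcases ht with ht | ht
  · have : Iio (0 : ℝ) ⊆ {t | deriv (deriv P) t = 0} := fun x hx => by
      have : deriv P =ᶠ[𝓝 x] fun _ => 0 := by
        filter_upwards [Iio_mem_nhds hx] with y hy using h.deriv_eq_zero (Or.inl (le_of_lt hy))
      simpa using this.deriv_eq
    have h2 := hcl.closure_subset_iff.2 this
    rw [closure_Iio] at h2
    exact h2 ht
  · have : Ioi η ⊆ {t | deriv (deriv P) t = 0} := fun x hx => by
      have : deriv P =ᶠ[𝓝 x] fun _ => 0 := by
        filter_upwards [Ioi_mem_nhds hx] with y hy using h.deriv_eq_zero (Or.inr (le_of_lt hy))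
      simpa using this.deriv_eq
    have h2 := hcl.closure_subset_iff.2 this
    rw [closure_Ioi] at h2
    exact h2 ht

theorem continuous_density (h : SmoothProfile η s P) {a : ℝ} (ha : 0 ≤ a) :
    Continuous (profileDensity a P) := by
  unfold profileDensity
  exact (h.continuous_deriv2.pow 2).add
    ((h.contDiff_deriv.continuous.abs).rpow_const fun _ => Or.inr ha)

theorem ofReal_integral_density (h : SmoothProfile η s P) {a : ℝ} (ha : 0 ≤ a) (hη : 0 < η) :
    ENNReal.ofReal (∫ t in (0 : ℝ)..η, profileDensity a P t) =
      ∫⁻ t in Ioo 0 η, ENNReal.ofReal (profileDensity a P t) := by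
  rw [intervalIntegral.integral_of_le hη.le, integral_Ioc_eq_integral_Ioo,
    ofReal_integral_eq_lintegral_ofReal]
  · exact ((h.continuous_density ha).integrableOn_Icc (a := 0) (b := η)).mono_set Ioo_subset_Icc_self
  · exact ae_of_all _ fun t => profileDensity_nonneg a P t

/-- Rescaling of a unit transition to a transition from `0` to `s` with optimal width. -/
theorem rescale (h : SmoothProfile η 1 P) {a : ℝ} (ha : a ∈ Ico (0 : ℝ) 1) {s : ℝ} (hs : s ≠ 0) :
    ∃ ℓ > 0, SmoothProfile (η * ℓ) s (fun t => s * P (t / ℓ)) ∧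
      ∫ t in (0 : ℝ)..(η * ℓ), profileDensity a (fun t => s * P (t / ℓ)) t =
        |s| ^ ((2 + a) / (4 - a)) * ∫ t in (0 : ℝ)..η, profileDensity a P t := by
  have hs0 : 0 < |s| := abs_pos.2 hs
  have ha1 := ha.2
  have h4 : (4 - a) ≠ 0 := by linarith
  -- The width that balances the two terms: `s² / ℓ⁴ = (|s| / ℓ) ^ a`. Both factors then equal `|s|
  -- ^ θ / ℓ`, and the change of variables cancels the `ℓ`.
  set ℓ := |s| ^ ((2 - a) / (4 - a)) with hℓ
  have hℓ0 : 0 < ℓ := Real.rpow_pos_of_pos hs0 _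
  have e1 : deriv (fun t => s * P (t / ℓ)) = fun t => s / ℓ * deriv P (t / ℓ) := by
    funext t
    have := ((h.hasDerivAt (t / ℓ)).comp t ((hasDerivAt_id t).div_const ℓ)).const_mul s
    refine this.deriv.trans ?_
    ring
  have e2 : deriv (deriv (fun t => s * P (t / ℓ))) =
      fun t => s / ℓ ^ 2 * deriv (deriv P) (t / ℓ) := by
    rw [e1]
    funext t
    have := ((h.hasDerivAt_deriv (t / ℓ)).comp t ((hasDerivAt_id t).div_const ℓ)).const_mul (s / ℓ)
    refine this.deriv.trans ?_
    ring
  refine ⟨ℓ, hℓ0, ⟨?_, ?_, ?_⟩, ?_⟩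
  · exact contDiff_const.mul (h.contDiff.comp (contDiff_id.div_const ℓ))
  · intro t ht
    simp [h.left (t / ℓ) (div_nonpos_of_nonpos_of_nonneg ht hℓ0.le)]
  · intro t ht
    simp [h.right (t / ℓ) ((le_div_iff₀ hℓ0).2 ht)]
  · set θ := (2 + a) / (4 - a) with hθ
    have k1 : (s / ℓ ^ 2) ^ 2 = |s| ^ θ / ℓ := by
      have : (s / ℓ ^ 2) ^ 2 = |s| ^ (2 : ℝ) / ℓ ^ (4 : ℝ) := by
        rw [div_pow, ← pow_mul, ← sq_abs]
        norm_cast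
      rw [this, eq_div_iff hℓ0.ne', div_mul_eq_mul_div, div_eq_iff (by positivity)]
      rw [hℓ, ← Real.rpow_mul hs0.le, ← Real.rpow_add hs0, ← Real.rpow_add hs0]
      congr 1
      rw [hθ]; field_simp; ring
    have k2 : |s / ℓ| ^ a = |s| ^ θ / ℓ := by
      rw [abs_div, abs_of_pos hℓ0, Real.div_rpow hs0.le hℓ0.le, eq_div_iff hℓ0.ne',
        div_mul_eq_mul_div, div_eq_iff (by positivity), hℓ, ← Real.rpow_mul hs0.le,
        ← Real.rpow_add hs0, ← Real.rpow_add hs0]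
      congr 1
      rw [hθ]; field_simp; ring
    have e3 : profileDensity a (fun t => s * P (t / ℓ)) =
        fun t => |s| ^ θ / ℓ * profileDensity a P (t / ℓ) := by
      funext t
      unfold profileDensity
      rw [e2, e1]
      simp only
      rw [mul_pow, abs_mul, Real.mul_rpow (abs_nonneg _) (abs_nonneg _), k1, k2]
      ring
    rw [e3, intervalIntegral.integral_const_mul, intervalIntegral.integral_comp_div _ hℓ0.ne']
    rw [zero_div, mul_div_cancel_right₀ _ hℓ0.ne', smul_eq_mul]
    field_simp

end SmoothProfile

/-- For `0 < a < 1` this is subadditivity of `r ↦ r ^ a`; for `a = 0` the power is constantly `1`,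
even at zero. The bound `κ ≤ 1` serves to keep `|x| ^ a ≤ 1` whenever `|x| ≤ κ`. -/
theorem exists_modulus_abs_rpow {a : ℝ} (ha : a ∈ Ico (0 : ℝ) 1) {ε : ℝ} (hε : 0 < ε) :
    ∃ κ > 0, κ ≤ 1 ∧ ∀ x y : ℝ, |x - y| ≤ κ → |x| ^ a ≤ |y| ^ a + ε := by
  rcases eq_or_lt_of_le ha.1 with h0 | h0
  · refine ⟨1, one_pos, le_rfl, fun x y _ => ?_⟩
    rw [← h0, Real.rpow_zero, Real.rpow_zero]; linarith
  · refine ⟨min 1 (ε ^ (1 / a)), lt_min one_pos (by positivity), min_le_left _ _,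
      fun x y hxy => ?_⟩
    have h1 : |x| ≤ |y| + |x - y| := by
      have := abs_add_le y (x - y); rwa [add_sub_cancel] at this
    have h2 : |x| ^ a ≤ (|y| + |x - y|) ^ a := Real.rpow_le_rpow (abs_nonneg _) h1 h0.le
    have h3 : (|y| + |x - y|) ^ a ≤ |y| ^ a + |x - y| ^ a :=
      Real.rpow_add_le_add_rpow (abs_nonneg _) (abs_nonneg _) h0.le ha.2.le
    have h4 : |x - y| ^ a ≤ ε := by
      calc |x - y| ^ a ≤ (ε ^ (1 / a)) ^ a :=
            Real.rpow_le_rpow (abs_nonneg _) (hxy.trans (min_le_right _ _)) h0.le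
        _ = ε := by rw [← Real.rpow_mul hε.le, one_div_mul_cancel h0.ne', Real.rpow_one]
    linarith

/-- Moving averages do not increase the `L²` norm. -/
theorem lintegral_sq_average_le {G : ℝ → ℝ} (hG : Measurable G) {h : ℝ} (hh : 0 < h) :
    ∫⁻ t, ENNReal.ofReal (((∫ r in (t - h)..t, G r) / h) ^ 2) ≤
      ∫⁻ r, ENNReal.ofReal (G r ^ 2) := by
  have hpt : ∀ t, ENNReal.ofReal (((∫ r in (t - h)..t, G r) / h) ^ 2) ≤
      ENNReal.ofReal h⁻¹ * ∫⁻ r in Ioc (t - h) t, ENNReal.ofReal (G r ^ 2) := by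
    intro t
    have e1 : ∀ x : ℝ, ENNReal.ofReal (x ^ 2) = ‖x‖ₑ ^ (2 : ℝ) := by
      intro x
      rw [← sq_abs, ← Real.norm_eq_abs, ENNReal.ofReal_pow (norm_nonneg _), ofReal_norm]
      norm_cast
    -- Cauchy–Schwarz against the constant `1` on a window of length `h`. Tonelli then finishes:
    -- each `r` lies in the windows of a set of `t` of length exactly `h`.
    have hcs := ENNReal.lintegral_mul_le_Lp_mul_Lq (volume.restrict (Ioc (t - h) t))
      Real.HolderConjugate.two_two (f := fun r => ‖G r‖ₑ) (g := fun _ => 1)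
      hG.enorm.aemeasurable aemeasurable_const
    simp only [Pi.mul_apply, mul_one, ENNReal.one_rpow, lintegral_const, MeasurableSet.univ,
      Measure.restrict_apply, univ_inter, Real.volume_Ioc, sub_sub_cancel, one_mul] at hcs
    have hb : ‖∫ r in (t - h)..t, G r‖ₑ ≤ ∫⁻ r in Ioc (t - h) t, ‖G r‖ₑ := by
      rw [intervalIntegral.integral_of_le (by linarith)]
      exact enorm_integral_le_lintegral_enorm _
    have h2 := ENNReal.rpow_le_rpow (hb.trans hcs) (z := 2) (by norm_num)
    rw [ENNReal.mul_rpow_of_nonneg _ _ (by norm_num), ← ENNReal.rpow_mul, ← ENNReal.rpow_mul] at h2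
    norm_num at h2
    have e2 : ENNReal.ofReal (((∫ r in (t - h)..t, G r) / h) ^ 2) =
        ENNReal.ofReal (h⁻¹ ^ 2) * ENNReal.ofReal ((∫ r in (t - h)..t, G r) ^ 2) := by
      rw [← ENNReal.ofReal_mul (by positivity)]
      congr 1
      field_simp
    rw [e2]
    simp_rw [e1 (G _), e1 (∫ r in (t - h)..t, G r)]
    norm_num
    calc ENNReal.ofReal ((h ^ 2)⁻¹) * ‖∫ r in (t - h)..t, G r‖ₑ ^ 2
        ≤ ENNReal.ofReal ((h ^ 2)⁻¹) *
          ((∫⁻ r in Ioc (t - h) t, ‖G r‖ₑ ^ 2) * ENNReal.ofReal h) := by gcongr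
      _ = (ENNReal.ofReal ((h ^ 2)⁻¹) * ENNReal.ofReal h) *
          ∫⁻ r in Ioc (t - h) t, ‖G r‖ₑ ^ 2 := by ring
      _ = _ := by
          rw [← ENNReal.ofReal_mul (by positivity)]
          congr 2
          field_simp
  calc _ ≤ ∫⁻ t, ENNReal.ofReal h⁻¹ * ∫⁻ r in Ioc (t - h) t, ENNReal.ofReal (G r ^ 2) :=
        lintegral_mono hpt
    _ = ENNReal.ofReal h⁻¹ * ∫⁻ t, ∫⁻ r in Ioc (t - h) t, ENNReal.ofReal (G r ^ 2) :=
        lintegral_const_mul' _ _ ENNReal.ofReal_ne_top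
    _ = ENNReal.ofReal h⁻¹ * ∫⁻ t, ∫⁻ r, {p : ℝ × ℝ | p.2 ∈ Ioc (p.1 - h) p.1}.indicator
          (fun p => ENNReal.ofReal (G p.2 ^ 2)) (t, r) := by
        congr 1
        refine lintegral_congr fun t => ?_
        rw [← lintegral_indicator measurableSet_Ioc]
        refine lintegral_congr fun r => ?_
        simp [indicator]
    _ = ENNReal.ofReal h⁻¹ * ∫⁻ r, ∫⁻ t, {p : ℝ × ℝ | p.2 ∈ Ioc (p.1 - h) p.1}.indicator
          (fun p => ENNReal.ofReal (G p.2 ^ 2)) (t, r) := by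
        congr 1
        apply lintegral_lintegral_swap
        apply Measurable.aemeasurable
        apply Measurable.indicator
        · exact ((hG.comp measurable_snd).pow_const 2).ennreal_ofReal
        · exact (measurableSet_lt (measurable_fst.sub_const h) measurable_snd).inter
            (measurableSet_le measurable_snd measurable_fst)
    _ = ENNReal.ofReal h⁻¹ * ∫⁻ r, ENNReal.ofReal (G r ^ 2) * ENNReal.ofReal h := by
        congr 1
        refine lintegral_congr fun r => ?_
        have : ∀ t, {p : ℝ × ℝ | p.2 ∈ Ioc (p.1 - h) p.1}.indicator
          (fun p => ENNReal.ofReal (G p.2 ^ 2)) (t, r) =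
          (Ico r (r + h)).indicator (fun _ => ENNReal.ofReal (G r ^ 2)) t := by
          intro t
          simp only [indicator, mem_ofPred_eq, mem_Ioc, mem_Ico]
          congr 1
          rw [sub_lt_iff_lt_add]
          exact propext and_comm
        simp_rw [this]
        rw [lintegral_indicator measurableSet_Ico]
        simp
    _ = _ := by
        rw [lintegral_mul_const' _ _ ENNReal.ofReal_ne_top, mul_comm, mul_assoc,
          ← ENNReal.ofReal_mul hh.le, mul_inv_cancel₀ hh.ne', ENNReal.ofReal_one, mul_one]

/-- Every profile can be smoothed at an arbitrarily small cost. -/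
theorem IsProfile.exists_smoothProfile {η a : ℝ} {ψ p g : ℝ → ℝ} (h : IsProfile η 1 ψ p g)
    (hη : 0 < η) (ha : a ∈ Ico (0 : ℝ) 1) {δ : ℝ} (hδ : 0 < δ) :
    ∃ η' > 0, ∃ P, SmoothProfile η' 1 P ∧
      ∫⁻ t in Ioo 0 η', ENNReal.ofReal (profileDensity a P t) ≤
        (∫⁻ t in Ioo 0 η, ENNReal.ofReal (g t ^ 2 + |p t| ^ a)) + ENNReal.ofReal δ := by
  classical
  set G₀ := h.memLp.aestronglyMeasurable.mk g with hG₀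
  have hG₀m : StronglyMeasurable G₀ := h.memLp.aestronglyMeasurable.stronglyMeasurable_mk
  have hgG₀ : g =ᵐ[volume.restrict (Ioo 0 η)] G₀ := h.memLp.aestronglyMeasurable.ae_eq_mk
  -- Extension by zero. Because `p` vanishes at both ends, the primitive `Q` of `G` is continuous on
  -- the whole line and zero off `(0, η)`, and its primitive `W` is `0` on the left and `1` on the
  -- right.
  set G : ℝ → ℝ := (Ioo 0 η).indicator G₀ with hG
  have hGm : Measurable G := hG₀m.measurable.indicator measurableSet_Ioo
  have hgG : g =ᵐ[volume.restrict (Ioo 0 η)] G := by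
    filter_upwards [hgG₀, ae_restrict_mem measurableSet_Ioo] with t ht ht'
    rw [hG, indicator_of_mem ht', ht]
  have hGint : Integrable G := by
    rw [hG, integrable_indicator_iff measurableSet_Ioo]
    exact ((h.memLp.integrable (by norm_num)).congr hgG₀ :)
  have hGi : ∀ x y : ℝ, IntervalIntegrable G volume x y := fun x y => hGint.intervalIntegrable
  set Q : ℝ → ℝ := fun t => ∫ r in (0 : ℝ)..t, G r with hQ
  have hQc : Continuous Q := intervalIntegral.continuous_primitive hGi 0
  have hQp : ∀ t ∈ Icc 0 η, Q t = p t := by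
    intro t ht
    rw [h.deriv_eq t ht, h.deriv_left, zero_add, hQ]
    simp only
    rw [intervalIntegral.integral_of_le ht.1, intervalIntegral.integral_of_le ht.1,
      integral_Ioc_eq_integral_Ioo, integral_Ioc_eq_integral_Ioo]
    have : g =ᵐ[volume.restrict (Ioo 0 t)] G :=
      ae_restrict_of_ae_restrict_of_subset (Ioo_subset_Ioo_right ht.2) hgG
    exact integral_congr_ae this.symm
  have hQ0 : ∀ t ≤ 0, Q t = 0 := by
    intro t ht
    rw [hQ]
    simp only
    rw [intervalIntegral.integral_of_ge ht, setIntegral_eq_zero_of_forall_eq_zero, neg_zero]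
    intro x hx
    rw [hG, indicator_of_notMem]
    exact fun hx' => absurd hx.2 (not_le.2 hx'.1)
  have hQη : ∀ t, η ≤ t → Q t = 0 := by
    intro t ht
    have : Q t = Q η + ∫ r in η..t, G r :=
      (intervalIntegral.integral_add_adjacent_intervals (hGi _ _) (hGi _ _)).symm
    rw [this, hQp η ⟨hη.le, le_rfl⟩, h.deriv_right, zero_add,
      intervalIntegral.integral_of_le ht, setIntegral_eq_zero_of_forall_eq_zero]
    intro x hx
    rw [hG, indicator_of_notMem]
    exact fun hx' => absurd hx.1 (not_lt.2 hx'.2.le)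
  have hQi : ∀ x y : ℝ, IntervalIntegrable Q volume x y := fun x y => hQc.intervalIntegrable _ _
  set W : ℝ → ℝ := fun t => ∫ r in (0 : ℝ)..t, Q r with hW
  have hWd : ∀ t, HasDerivAt W (Q t) t := fun t => hQc.integral_hasStrictDerivAt 0 t |>.hasDerivAt
  have hWc : Continuous W := continuous_iff_continuousAt.2 fun t => (hWd t).continuousAt
  have hW0 : ∀ t ≤ 0, W t = 0 := by
    intro t ht
    rw [hW]
    simp only
    rw [intervalIntegral.integral_of_ge ht, setIntegral_eq_zero_of_forall_eq_zero, neg_zero]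
    exact fun x hx => hQ0 x hx.2
  have hWη : ∀ t, η ≤ t → W t = 1 := by
    intro t ht
    have e1 : W t = W η + ∫ r in η..t, Q r :=
      (intervalIntegral.integral_add_adjacent_intervals (hQi _ _) (hQi _ _)).symm
    have e2 : W η = 1 := by
      rw [← h.value_right, h.value_eq η ⟨hη.le, le_rfl⟩, h.value_left, zero_add, hW]
      refine intervalIntegral.integral_congr fun x hx => ?_
      rw [uIcc_of_le hη.le] at hx
      exact hQp x hx
    rw [e1, e2, intervalIntegral.integral_of_le ht, setIntegral_eq_zero_of_forall_eq_zero, add_zero]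
    exact fun x hx => hQη x hx.1.le
  -- the smoothing scale
  obtain ⟨κ, hκ, hκ1, hmod⟩ := exists_modulus_abs_rpow ha (ε := δ / (2 * η)) (by positivity)
  have hQunif : UniformContinuous Q := by
    apply hQc.uniformContinuous_of_tendsto_cocompact (x := 0)
    rw [Metric.cobounded_eq_cocompact.symm]
    refine tendsto_const_nhds.congr' ?_
    have : (Icc 0 η)ᶜ ∈ Bornology.cobounded ℝ := (Metric.isBounded_Icc 0 η).compl
    filter_upwards [this] with t ht
    by_cases h0 : t ≤ 0
    · exact (hQ0 t h0).symm
    · exact (hQη t (by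
        by_contra hc
        exact ht ⟨(not_le.1 h0).le, (not_le.1 hc).le⟩)).symm
  rw [Metric.uniformContinuous_iff] at hQunif
  obtain ⟨τ, hτ, hQu⟩ := hQunif κ hκ
  -- A window shorter than `τ` keeps the averaged derivative within `κ` of `Q`. On the additional
  -- interval `[η, η + k)` the density `|D₁| ^ a` is at most `1`, so that `k ≤ δ / 2` bounds its
  -- cost.
  set k := min (τ / 2) (δ / 2) with hk
  have hk0 : 0 < k := lt_min (by positivity) (by positivity)
  set D₁ : ℝ → ℝ := fun t => (W t - W (t - k)) / k with hD₁
  set D₂ : ℝ → ℝ := fun t => (Q t - Q (t - k)) / k with hD₂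
  -- The average of `W` over `[t - k, t]`. A trailing window leaves the left end at `0` and only
  -- moves the right end to `η + k`. The second derivative is a difference quotient of the
  -- continuous function `Q`, hence continuous.
  set P : ℝ → ℝ := fun t => ((∫ r in (0 : ℝ)..t, W r) - ∫ r in (0 : ℝ)..(t - k), W r) / k with hP
  have hWi : ∀ x y : ℝ, IntervalIntegrable W volume x y := fun x y => hWc.intervalIntegrable _ _
  have hP1 : ∀ t, P t = (∫ r in (t - k)..t, W r) / k := by
    intro t
    rw [hP]
    simp only
    rw [intervalIntegral.integral_interval_sub_left (hWi _ _) (hWi _ _)]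
  have hD1 : ∀ t, D₁ t = (∫ r in (t - k)..t, Q r) / k := by
    intro t
    rw [hD₁, hW]
    simp only
    rw [intervalIntegral.integral_interval_sub_left (hQi _ _) (hQi _ _)]
  have hD2 : ∀ t, D₂ t = (∫ r in (t - k)..t, G r) / k := by
    intro t
    rw [hD₂, hQ]
    simp only
    rw [intervalIntegral.integral_interval_sub_left (hGi _ _) (hGi _ _)]
  have hPd : ∀ t, HasDerivAt P (D₁ t) t := by
    intro t
    have hd : ∀ t, HasDerivAt (fun t => ∫ r in (0 : ℝ)..t, W r) (W t) t := fun t =>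
      hWc.integral_hasStrictDerivAt 0 t |>.hasDerivAt
    exact ((hd t).sub ((hd (t - k)).comp_sub_const t k)).div_const k
  have hD₁d : ∀ t, HasDerivAt D₁ (D₂ t) t := fun t =>
    ((hWd t).sub ((hWd (t - k)).comp_sub_const t k)).div_const k
  have hdP : deriv P = D₁ := funext fun t => (hPd t).deriv
  have hddP : deriv (deriv P) = D₂ := by rw [hdP]; exact funext fun t => (hD₁d t).deriv
  refine ⟨η + k, by positivity, P, ⟨contDiff_two_of_hasDerivAt hPd hD₁d ?_, ?_, ?_⟩, ?_⟩
  · exact (hQc.sub (hQc.comp (continuous_id.sub continuous_const))).div_const k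
  · intro t ht
    rw [hP1, intervalIntegral.integral_congr (g := fun _ => 0), intervalIntegral.integral_zero,
      zero_div]
    intro x hx
    rw [uIcc_of_le (by linarith)] at hx
    exact hW0 x (hx.2.trans ht)
  · intro t ht
    rw [hP1, intervalIntegral.integral_congr (g := fun _ => 1), intervalIntegral.integral_const,
      smul_eq_mul, mul_one, sub_sub_cancel, div_self hk0.ne']
    intro x hx
    rw [uIcc_of_le (by linarith)] at hx
    exact hWη x (by linarith [hx.1])
  · have hclose : ∀ t, |D₁ t - Q t| ≤ κ := by
      intro t
      have e : D₁ t - Q t = (∫ r in (t - k)..t, (Q r - Q t)) / k := by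
        rw [intervalIntegral.integral_sub (hQi _ _) (by simp), hD1,
          intervalIntegral.integral_const, smul_eq_mul, sub_sub_cancel]
        field_simp
      have hb : ‖∫ r in (t - k)..t, (Q r - Q t)‖ ≤ κ * |t - (t - k)| := by
        apply intervalIntegral.norm_integral_le_of_norm_le_const
        intro x hx
        rw [uIoc_of_le (by linarith)] at hx
        have : dist x t < τ := by
          rw [Real.dist_eq, abs_lt]
          have := min_le_left (τ / 2) (δ / 2)
          constructor <;> linarith [hx.1, hx.2]
        exact (hQu this).le
      rw [e, abs_div, abs_of_pos hk0, div_le_iff₀ hk0]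
      rw [sub_sub_cancel, abs_of_pos hk0] at hb
      exact hb
    have hdens : ∀ t, ENNReal.ofReal (profileDensity a P t) =
        ENNReal.ofReal (D₂ t ^ 2) + ENNReal.ofReal (|D₁ t| ^ a) := by
      intro t
      unfold profileDensity
      rw [hddP, hdP, ENNReal.ofReal_add (by positivity) (by positivity)]
    have hD₁c : Continuous D₁ := continuous_iff_continuousAt.2 fun t => (hD₁d t).continuousAt
    have hD₁m : Measurable fun t => ENNReal.ofReal (|D₁ t| ^ a) :=
      (hD₁c.measurable.norm.pow_const a).ennreal_ofReal
    have hA : ∫⁻ t in Ioo 0 (η + k), ENNReal.ofReal (D₂ t ^ 2) ≤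
        ∫⁻ t in Ioo 0 η, ENNReal.ofReal (g t ^ 2) := by
      calc _ ≤ ∫⁻ t, ENNReal.ofReal (D₂ t ^ 2) := setLIntegral_le_lintegral _ _
        _ ≤ ∫⁻ t, ENNReal.ofReal (G t ^ 2) := by
            simp_rw [hD2]
            exact lintegral_sq_average_le hGm hk0
        _ = ∫⁻ t in Ioo 0 η, ENNReal.ofReal (G t ^ 2) := by
            rw [← lintegral_indicator measurableSet_Ioo]
            refine lintegral_congr fun t => ?_
            by_cases ht : t ∈ Ioo 0 η
            · rw [indicator_of_mem ht]
            · rw [indicator_of_notMem ht, hG, indicator_of_notMem ht]; simp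
        _ = _ := lintegral_congr_ae (by filter_upwards [hgG] with t ht; rw [ht])
    have hB : ∫⁻ t in Ioo 0 (η + k), ENNReal.ofReal (|D₁ t| ^ a) ≤
        (∫⁻ t in Ioo 0 η, ENNReal.ofReal (|p t| ^ a)) + ENNReal.ofReal δ := by
      have hsub : Ioo 0 (η + k) ⊆ Ioo 0 η ∪ Ico η (η + k) := by
        intro t ht
        by_cases h1 : t < η
        · exact Or.inl ⟨ht.1, h1⟩
        · exact Or.inr ⟨not_lt.1 h1, ht.2⟩
      calc _ ≤ ∫⁻ t in Ioo 0 η ∪ Ico η (η + k), ENNReal.ofReal (|D₁ t| ^ a) :=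
            lintegral_mono_set hsub
        _ ≤ (∫⁻ t in Ioo 0 η, ENNReal.ofReal (|D₁ t| ^ a)) +
            ∫⁻ t in Ico η (η + k), ENNReal.ofReal (|D₁ t| ^ a) := lintegral_union_le _ _ _
        _ ≤ (∫⁻ t in Ioo 0 η, (ENNReal.ofReal (|p t| ^ a) + ENNReal.ofReal (δ / (2 * η)))) +
            ∫⁻ t in Ico η (η + k), 1 := by
            gcongr ?_ + ?_
            · refine setLIntegral_mono' measurableSet_Ioo fun t ht => ?_
              rw [← ENNReal.ofReal_add (by positivity) (by positivity)]
              apply ENNReal.ofReal_le_ofReal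
              rw [← hQp t (Ioo_subset_Icc_self ht)]
              exact hmod _ _ (hclose t)
            · refine setLIntegral_mono' measurableSet_Ico fun t ht => ?_
              rw [← ENNReal.ofReal_one]
              apply ENNReal.ofReal_le_ofReal
              have h1 := hclose t
              rw [hQη t ht.1, sub_zero] at h1
              exact Real.rpow_le_one (abs_nonneg _) (h1.trans hκ1) ha.1
        _ = (∫⁻ t in Ioo 0 η, ENNReal.ofReal (|p t| ^ a)) +
            (ENNReal.ofReal (δ / 2) + ENNReal.ofReal k) := by
            rw [lintegral_add_right _ measurable_const, add_assoc]
            congr 2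
            · rw [lintegral_const, Measure.restrict_apply_univ, Real.volume_Ioo, sub_zero,
                ← ENNReal.ofReal_mul (by positivity)]
              congr 1
              field_simp
            · rw [lintegral_const, Measure.restrict_apply_univ, Real.volume_Ico, one_mul]
              congr 1; ring
        _ ≤ _ := by
            rw [← ENNReal.ofReal_add (by positivity) hk0.le]
            gcongr
            have := min_le_right (τ / 2) (δ / 2)
            linarith
    simp_rw [hdens]
    rw [lintegral_add_right _ hD₁m]
    have hsplit : ∫⁻ t in Ioo 0 η, ENNReal.ofReal (g t ^ 2 + |p t| ^ a) =
        (∫⁻ t in Ioo 0 η, ENNReal.ofReal (g t ^ 2)) +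
          ∫⁻ t in Ioo 0 η, ENNReal.ofReal (|p t| ^ a) := by
      rw [← lintegral_add_right']
      · refine lintegral_congr fun t => ENNReal.ofReal_add (by positivity) (by positivity)
      · have : Measurable fun t => ENNReal.ofReal (|Q t| ^ a) :=
          (hQc.measurable.norm.pow_const a).ennreal_ofReal
        refine this.aemeasurable.congr ?_
        filter_upwards [ae_restrict_mem measurableSet_Ioo] with t ht
        rw [hQp t (Ioo_subset_Icc_self ht)]
    rw [hsplit, add_assoc]
    exact add_le_add hA hB

/-- The cubic `3 t² - 2 t³` is a profile. -/
theorem isProfile_cubic : IsProfile 1 1 (fun t => 3 * t ^ 2 - 2 * t ^ 3)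
    (fun t => 6 * t - 6 * t ^ 2) (fun t => 6 - 12 * t) where
  memLp := by
    refine MemLp.of_bound (by fun_prop) 6 ?_
    filter_upwards [ae_restrict_mem measurableSet_Ioo] with t ht
    rw [Real.norm_eq_abs, abs_le]
    constructor <;> linarith [ht.1, ht.2]
  deriv_eq t _ := by
    rw [intervalIntegral.integral_eq_sub_of_hasDerivAt (f := fun t => 6 * t - 6 * t ^ 2)]
    · simp
    · intro x _
      have := ((hasDerivAt_id x).const_mul 6).sub ((hasDerivAt_pow 2 x).const_mul 6)
      refine this.congr_deriv ?_
      simp; ring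
    · exact (by fun_prop : Continuous fun t : ℝ => 6 - 12 * t).intervalIntegrable _ _
  value_eq t _ := by
    rw [intervalIntegral.integral_eq_sub_of_hasDerivAt (f := fun t => 3 * t ^ 2 - 2 * t ^ 3)]
    · simp
    · intro x _
      have := ((hasDerivAt_pow 2 x).const_mul 3).sub ((hasDerivAt_pow 3 x).const_mul 2)
      refine this.congr_deriv ?_
      simp; ring
    · exact (by fun_prop : Continuous fun t : ℝ => 6 * t - 6 * t ^ 2).intervalIntegrable _ _
  value_left := by norm_num
  value_right := by norm_num
  deriv_left := by norm_num
  deriv_right := by norm_num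

/-- The cubic profile has finite energy. Finiteness leaves room for a constant strictly above the
optimal one, which a smooth profile can then beat. -/
theorem sigma_ne_top {a : ℝ} (ha : a ∈ Ico (0 : ℝ) 1) : sigma a ≠ ⊤ := by
  refine ENNReal.mul_ne_top (by norm_num) ?_
  refine ne_top_of_le_ne_top ?_ (iInf₂_le_of_le (1 : ℝ) one_pos (iInf_le_of_le _ (iInf_le_of_le _
    (iInf_le_of_le _ (iInf_le_of_le isProfile_cubic le_rfl)))))
  have hc : Continuous fun t : ℝ => (6 - 12 * t) ^ 2 + |6 * t - 6 * t ^ 2| ^ a :=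
    (by fun_prop : Continuous fun t : ℝ => (6 - 12 * t) ^ 2).add
      ((by fun_prop : Continuous fun t : ℝ => |6 * t - 6 * t ^ 2|).rpow_const fun _ => Or.inr ha.1)
  have hi := (hc.integrableOn_Icc (a := 0) (b := 1)).mono_set (μ := volume) Ioo_subset_Icc_self
  exact hi.lintegral_lt_top.ne

/-- Smooth transitions nearly realize the optimal energy. -/
theorem exists_smoothProfile_lt {a : ℝ} (ha : a ∈ Ico (0 : ℝ) 1) (s : ℝ) {J : ℝ≥0∞}
    (hJ : sigma a * ENNReal.ofReal (|s| ^ ((2 + a) / (4 - a))) < J) :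
    ∃ η > 0, ∃ P, SmoothProfile η s P ∧
      ENNReal.ofReal (1 / 2 * ∫ t in (0 : ℝ)..η, profileDensity a P t) < J := by
  rcases eq_or_ne s 0 with rfl | hs
  -- For `s = 0` the zero profile is used, but with a short interval: when `a = 0` its density is `0
  -- ^ 0 = 1`, so that the energy is proportional to the width.
  · obtain ⟨r, hr0, hr⟩ := ENNReal.lt_iff_exists_nnreal_btwn.1 (bot_le.trans_lt hJ)
    have hr0 : 0 < r := by simpa using hr0
    refine ⟨r, by simpa using hr0, fun _ => 0, ⟨contDiff_const, fun _ _ => rfl, fun _ _ => rfl⟩, ?_⟩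
    refine lt_of_le_of_lt ?_ hr
    rw [← ENNReal.ofReal_coe_nnreal]
    apply ENNReal.ofReal_le_ofReal
    have : ∀ t, profileDensity a (fun _ => 0) t = 0 ^ a := by
      intro t; simp [profileDensity]
    simp_rw [this]
    have h01 : (0 : ℝ) ^ a ≤ 1 := Real.zero_rpow_le_one a
    simp only [intervalIntegral.integral_const, sub_zero, smul_eq_mul]
    have hr' : (0 : ℝ) < r := hr0
    nlinarith [mul_le_mul_of_nonneg_left h01 hr'.le]
  · set c := |s| ^ ((2 + a) / (4 - a)) with hc
    have hc0 : 0 < c := Real.rpow_pos_of_pos (abs_pos.2 hs) _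
    have hcE : ENNReal.ofReal c ≠ 0 := by simpa using hc0
    have h1 : sigma a < J / ENNReal.ofReal c := by
      rw [ENNReal.lt_div_iff_mul_lt (Or.inl hcE) (Or.inl ENNReal.ofReal_ne_top)]
      exact hJ
    unfold sigma profileEnergy at h1
    rw [mul_comm, ← ENNReal.lt_div_iff_mul_lt (by norm_num) (by norm_num)] at h1
    simp only [iInf_lt_iff] at h1
    obtain ⟨η, hη, ψ, p, g, hpr, hlt⟩ := h1
    obtain ⟨δ, hδ, hlt'⟩ : ∃ δ : ℝ, 0 < δ ∧
        (∫⁻ t in Ioo 0 η, ENNReal.ofReal (g t ^ 2 + |p t| ^ a)) + ENNReal.ofReal δ <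
          J / ENNReal.ofReal c / (1 / 2) := by
      obtain ⟨r, hr, hr'⟩ := ENNReal.lt_iff_exists_add_pos_lt.1 hlt
      exact ⟨r, hr, by rwa [ENNReal.ofReal_coe_nnreal]⟩
    obtain ⟨η', hη', P, hP, hle⟩ := hpr.exists_smoothProfile hη ha hδ
    have h2 := hle.trans_lt hlt'
    rw [← hP.ofReal_integral_density ha.1 hη',
      ENNReal.lt_div_iff_mul_lt (by norm_num) (by norm_num),
      ENNReal.lt_div_iff_mul_lt (Or.inl hcE) (Or.inl ENNReal.ofReal_ne_top)] at h2
    obtain ⟨ℓ, hℓ, hPs, hint⟩ := hP.rescale ha hs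
    refine ⟨η' * ℓ, by positivity, _, hPs, ?_⟩
    rw [hint]
    convert h2 using 1
    have : (1 / 2 : ℝ≥0∞) = ENNReal.ofReal (1 / 2) := by
      rw [ENNReal.ofReal_div_of_pos (by norm_num)]; simp
    rw [this, ← ENNReal.ofReal_mul' (by norm_num), ← ENNReal.ofReal_mul' hc0.le]
    congr 1; ring

/-! ### Surface measure and straightening of level sets -/

theorem lintegral_comp_mul_left_real {h : ℝ → ℝ≥0∞} (hh : Measurable h) {k : ℝ} (hk : 0 < k) :
    ∫⁻ τ, h (k * τ) = ENNReal.ofReal k⁻¹ * ∫⁻ τ, h τ := by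
  rw [← lintegral_map hh (measurable_const_mul k), Real.map_volume_mul_left hk.ne',
    lintegral_smul_measure, abs_of_pos (inv_pos.2 hk), smul_eq_mul]

theorem _root_.LipschitzOnWith.euclideanHausdorffMeasure_image_le {X Y : Type*} [EMetricSpace X]
    [EMetricSpace Y] [MeasurableSpace X] [BorelSpace X] [MeasurableSpace Y] [BorelSpace Y]
    {K : ℝ≥0} {f : X → Y} {s : Set X} (h : LipschitzOnWith K f s) (d : ℕ) :
    μHE[d] (f '' s) ≤ (K : ℝ≥0∞) ^ d * μHE[d] s := by
  simp_rw [Measure.euclideanHausdorffMeasure_def, Measure.smul_apply, ENNReal.smul_def, smul_eq_mul]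
  have := h.hausdorffMeasure_image_le (d := d) (by positivity)
  rw [ENNReal.rpow_natCast] at this
  calc _ ≤ _ := mul_le_mul_right this _
    _ = _ := by ring

/-- Antilipschitz maps control the surface measure of a set by that of its image. -/
theorem euclideanHausdorffMeasure_le_of_edist_le {X Y : Type*} [EMetricSpace X]
    [EMetricSpace Y] [MeasurableSpace X] [BorelSpace X] [MeasurableSpace Y] [BorelSpace Y]
    {K : ℝ≥0} {f : X → Y} {s : Set X} (h : ∀ x ∈ s, ∀ y ∈ s, edist x y ≤ K * edist (f x) (f y))
    (d : ℕ) : μHE[d] s ≤ (K : ℝ≥0∞) ^ d * μHE[d] (f '' s) := by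
  rcases s.eq_empty_or_nonempty with rfl | ⟨x₀, hx₀⟩
  · simp
  have : Nonempty X := ⟨x₀⟩
  have hinj : InjOn f s := fun x hx y hy hxy => by
    have := h x hx y hy
    rw [hxy, edist_self, mul_zero] at this
    exact edist_eq_zero.1 (le_antisymm this bot_le)
  have hL : LipschitzOnWith K (Function.invFunOn f s) (f '' s) := by
    rintro _ ⟨x, hx, rfl⟩ _ ⟨y, hy, rfl⟩
    rw [hinj.leftInvOn_invFunOn hx, hinj.leftInvOn_invFunOn hy]
    exact h x hx y hy
  have := hL.euclideanHausdorffMeasure_image_le d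
  rwa [hinj.leftInvOn_invFunOn.image_image] at this

/-- Orthogonal coordinates with a prescribed first axis `e`. -/
structure IsAxisCoord {m : ℕ} (e : Rn (m + 1)) (T : Rn (m + 1) → ℝ × Rn m) : Prop where
  measurePreserving : MeasurePreserving T volume volume
  continuous : Continuous T
  fst_eq : ∀ y, (T y).1 = inner ℝ e y
  snd_add_smul : ∀ y (t : ℝ), (T (y + t • e)).2 = (T y).2
  dist_sq : ∀ y y', dist y y' ^ 2 = ((T y).1 - (T y').1) ^ 2 + dist (T y).2 (T y').2 ^ 2

/-- Complete `e` to an orthonormal basis and split off its first coordinate; every factor of the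
composition preserves volume. -/
theorem exists_isAxisCoord {m : ℕ} {e : Rn (m + 1)} (he : ‖e‖ = 1) :
    ∃ T : Rn (m + 1) → ℝ × Rn m, IsAxisCoord e T := by
  obtain ⟨b, hb⟩ := Orthonormal.exists_orthonormalBasis_extension_of_card_eq (𝕜 := ℝ)
    (E := Rn (m + 1)) (ι := Fin (m + 1)) (by simp) (v := fun _ => e) (s := {0}) (by
      rw [orthonormal_subsingleton_iff]
      exact fun _ => he)
  have hb0 : b 0 = e := hb 0 rfl
  refine ⟨fun y => (b.repr y 0, WithLp.toLp 2 fun i => b.repr y i.succ), ?_, ?_, ?_, ?_, ?_⟩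
  · have h1 := b.measurePreserving_repr
    have h2 := PiLp.volume_preserving_ofLp (Fin (m + 1))
    have h3 := volume_preserving_piFinSuccAbove (fun _ : Fin (m + 1) => ℝ) 0
    have h4 := (MeasurePreserving.id (volume : Measure ℝ)).prod (PiLp.volume_preserving_toLp (Fin m))
    exact h4.comp (h3.comp (h2.comp h1))
  · have hc : ∀ i, Continuous fun y => b.repr y i := fun i =>
      (EuclideanSpace.proj (𝕜 := ℝ) i).continuous.comp b.repr.continuous
    refine (hc 0).prodMk ?_
    exact (PiLp.continuous_toLp 2 _).comp (continuous_pi fun i => hc i.succ)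
  · intro y
    simp only
    rw [b.repr_apply_apply, hb0]
  · intro y t
    ext i
    simp only [map_add, map_smul]
    have : b.repr e i.succ = 0 := by
      rw [b.repr_apply_apply, ← hb0, b.orthonormal.2 (Fin.succ_ne_zero i)]
    simp [this]
  · intro y y'
    rw [← b.repr.dist_map y y', EuclideanSpace.dist_eq, EuclideanSpace.dist_eq,
      Real.sq_sqrt (by positivity), Real.sq_sqrt (by positivity), Fin.sum_univ_succ]
    congr 1
    rw [Real.dist_eq, sq_abs]

namespace IsAxisCoord
variable {m : ℕ} {e : Rn (m + 1)} {T : Rn (m + 1) → ℝ × Rn m}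

theorem dist_snd_le (hT : IsAxisCoord e T) (y y' : Rn (m + 1)) :
    dist (T y).2 (T y').2 ≤ dist y y' := by
  have := hT.dist_sq y y'
  exact abs_le_of_sq_le_sq' (by nlinarith [sq_nonneg ((T y).1 - (T y').1)]) dist_nonneg |>.2

theorem lipschitzWith_snd (hT : IsAxisCoord e T) : LipschitzWith 1 fun y => (T y).2 :=
  LipschitzWith.mk_one hT.dist_snd_le

theorem dist_eq_of_fst_eq (hT : IsAxisCoord e T) {y y' : Rn (m + 1)} (h : (T y).1 = (T y').1) :
    dist y y' = dist (T y).2 (T y').2 := by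
  have := hT.dist_sq y y'
  rw [h, sub_self, zero_pow two_ne_zero, zero_add] at this
  exact (pow_left_inj₀ dist_nonneg dist_nonneg two_ne_zero).1 this

end IsAxisCoord

/-- A chart near a regular point that straightens the level sets of `f` along the unit normal `e`,
without changing volumes by more than the factor `q`. -/
theorem exists_straightening {m : ℕ} {f : Rn (m + 1) → ℝ} {L : Rn (m + 1) →L[ℝ] ℝ}
    {z : Rn (m + 1)} (hf : HasStrictFDerivAt f L z) (hL : L ≠ 0) {q : ℝ≥0} (hq : q < 1) :
    ∃ e : Rn (m + 1), ‖e‖ = 1 ∧ ∃ s ∈ 𝓝 z, ∃ Ψ : Rn (m + 1) → Rn (m + 1),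
      (∀ y, Ψ y = y + (f y / ‖L‖ - inner ℝ e y) • e) ∧ (∀ y, inner ℝ e (Ψ y) = f y / ‖L‖) ∧
      (∀ t ⊆ s, q * volume t ≤ volume (Ψ '' t)) ∧
      ∀ x ∈ s, ∀ y ∈ s, dist x y ≤ 2 * dist (Ψ x) (Ψ y) := by
  have hb : 0 < ‖L‖ := norm_pos_iff.2 hL
  set g := (InnerProductSpace.toDual ℝ (Rn (m + 1))).symm L with hg
  have hgn : ‖g‖ = ‖L‖ := by rw [hg, LinearIsometryEquiv.norm_map]
  have hgi : ∀ v, inner ℝ g v = L v := fun v => InnerProductSpace.toDual_symm_apply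
  set e := ‖L‖⁻¹ • g with he
  have hen : ‖e‖ = 1 := by
    rw [he, norm_smul, hgn, norm_inv, norm_norm, inv_mul_cancel₀ hb.ne']
  have hei : ∀ v, inner ℝ e v = ‖L‖⁻¹ * L v := fun v => by
    rw [he, real_inner_smul_left, hgi]
  set Ψ : Rn (m + 1) → Rn (m + 1) := fun y => y + (f y / ‖L‖ - inner ℝ e y) • e with hΨ
  -- The differential of `f / ‖L‖` at `z` is `⟨e, ·⟩`, so the correction term has zero derivative
  -- there and `Ψ` is tangent to the identity.
  have hstrict : HasStrictFDerivAt Ψ (ContinuousLinearMap.id ℝ (Rn (m + 1))) z := by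
    have h1 : HasStrictFDerivAt (fun y : Rn (m + 1) => inner ℝ e y) (innerSL ℝ e) z :=
      (innerSL ℝ e).hasStrictFDerivAt
    have h2 := (hasStrictFDerivAt_id (𝕜 := ℝ) z).add
      ((((hf.mul_const ‖L‖⁻¹).sub h1)).smul_const e)
    refine HasStrictFDerivAt.congr_fderiv h2 ?_
    ext v : 1
    simp only [_root_.add_apply, ContinuousLinearMap.smulRight_apply,
      _root_.sub_apply, _root_.smul_apply, innerSL_apply_apply,
      ContinuousLinearMap.id_apply, hei, smul_eq_mul, sub_self, zero_smul, add_zero]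
  have hdet := mul_le_addHaar_image_of_lt_det (μ := (volume : Measure (Rn (m + 1))))
    (ContinuousLinearMap.id ℝ (Rn (m + 1))) (m := q) (by
      have : (ContinuousLinearMap.id ℝ (Rn (m + 1))).det = 1 := by
        simp [ContinuousLinearMap.det]
      rw [this]; simpa using hq)
  -- Linear approximation up to `δ` gives the volume bound for small `δ`, as the determinant `1`
  -- exceeds `q`; `δ < 1 / 2` gives the antilipschitz constant `2`.
  have hlt : ∀ᶠ δ in 𝓝[>] (0 : ℝ≥0), δ < 1 / 2 :=
    nhdsWithin_le_nhds (Iio_mem_nhds (by norm_num))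
  obtain ⟨δ, ⟨hδ1, hδ2⟩, hδ0⟩ := ((hdet.and hlt).and self_mem_nhdsWithin).exists
  obtain ⟨s, hs, happ⟩ := hstrict.approximates_deriv_on_nhds (c := δ) (Or.inr hδ0)
  refine ⟨e, hen, s, hs, Ψ, fun y => rfl, fun y => ?_, fun t ht => hδ1 t Ψ (happ.mono_set ht), ?_⟩
  · rw [hΨ]
    simp only
    rw [inner_add_right, inner_smul_right, real_inner_self_eq_norm_sq, hen]
    ring
  · intro x hx y hy
    have h1 := happ x hx y hy
    rw [ContinuousLinearMap.id_apply] at h1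
    rw [dist_eq_norm, dist_eq_norm]
    have h2 : ‖x - y‖ ≤ ‖Ψ x - Ψ y‖ + ‖Ψ x - Ψ y - (x - y)‖ := by
      have := norm_sub_le (Ψ x - Ψ y) (Ψ x - Ψ y - (x - y))
      rwa [sub_sub_cancel] at this
    have h3 : (δ : ℝ) ≤ 1 / 2 := by exact_mod_cast hδ2.le
    nlinarith [norm_nonneg (x - y)]

/-- Near a regular point, a level set is Lebesgue null and has finite surface measure. -/
theorem exists_nhds_levelSet_null {m : ℕ} {f : Rn (m + 1) → ℝ} {L : Rn (m + 1) →L[ℝ] ℝ}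
    {z : Rn (m + 1)} (hf : HasStrictFDerivAt f L z) (hL : L ≠ 0) :
    ∃ s ∈ 𝓝 z, volume (s ∩ {y | f y = 0}) = 0 ∧ μHE[m] (s ∩ {y | f y = 0}) < ⊤ := by
  obtain ⟨e, he, s, hs, Ψ, hΨ, hΨi, hvol, hdist⟩ :=
    exists_straightening hf hL (q := 1 / 2) (by
      rw [← NNReal.coe_lt_coe]; norm_num)
  obtain ⟨T, hT⟩ := exists_isAxisCoord he
  have hfst : ∀ y, f y = 0 → (T (Ψ y)).1 = 0 := fun y hy => by
    rw [hT.fst_eq, hΨi, hy, zero_div]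
  have hsnd : ∀ y, (T (Ψ y)).2 = (T y).2 := fun y => by rw [hΨ, hT.snd_add_smul]
  refine ⟨s ∩ Metric.ball z 1, inter_mem hs (Metric.ball_mem_nhds z one_pos), ?_, ?_⟩
  · have h1 := hvol (s ∩ Metric.ball z 1 ∩ {y | f y = 0}) (inter_subset_left.trans inter_subset_left)
    have h2 : volume (Ψ '' (s ∩ Metric.ball z 1 ∩ {y | f y = 0})) = 0 := by
      have : Ψ '' (s ∩ Metric.ball z 1 ∩ {y | f y = 0}) ⊆ T ⁻¹' (({0} : Set ℝ) ×ˢ univ) := by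
        rintro _ ⟨y, hy, rfl⟩
        exact ⟨hfst y hy.2, mem_univ _⟩
      refine measure_mono_null this ?_
      rw [hT.measurePreserving.measure_preimage
        ((measurableSet_singleton 0).prod MeasurableSet.univ).nullMeasurableSet, Measure.volume_eq_prod,
        Measure.prod_prod]
      simp
    rw [h2, nonpos_iff_eq_zero, mul_eq_zero] at h1
    exact h1.resolve_left (by norm_num)
  -- On the zero set `T ∘ Ψ` has vanishing first coordinate, so distances between the `Ψ`-images are
  -- distances between projections. The projection is thus antilipschitz there, with a bounded image
  -- in `Rn m`.
  · have h1 := euclideanHausdorffMeasure_le_of_edist_le (K := 2) (f := fun y => (T y).2)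
      (s := s ∩ Metric.ball z 1 ∩ {y | f y = 0}) (fun x hx y hy => by
        rw [edist_dist, edist_dist, show ((2 : ℝ≥0) : ℝ≥0∞) = ENNReal.ofReal 2 by simp,
          ← ENNReal.ofReal_mul (by norm_num)]
        apply ENNReal.ofReal_le_ofReal
        have := hdist x hx.1.1 y hy.1.1
        rwa [hT.dist_eq_of_fst_eq (y := Ψ x) (y' := Ψ y) (by rw [hfst x hx.2, hfst y hy.2]), hsnd, hsnd] at this) m
    refine h1.trans_lt (ENNReal.mul_lt_top (by simp) ?_)
    rw [EuclideanSpace.euclideanHausdorffMeasure_eq_volume]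
    refine Bornology.IsBounded.measure_lt_top ?_
    refine hT.lipschitzWith_snd.isBounded_image ((Metric.isBounded_ball (x := z) (r := 1)).subset ?_)
    exact inter_subset_left.trans inter_subset_right

/-! ### Asymptotic energy of thin layers around a level set -/

/-- The layer energy of `S` around the zero set of `f`, with layer profile `h`, is asymptotically
at most `C` times the area of the zero set in `S`. -/
def LayerBound {m : ℕ} (f : Rn (m + 1) → ℝ) (h : ℝ → ℝ≥0∞) (C : ℝ≥0∞) (S : Set (Rn (m + 1))) :
    Prop :=
  ∀ ε : ℝ≥0∞, ε ≠ 0 → ∀ᶠ t in 𝓝[>] (0 : ℝ),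
    ENNReal.ofReal t⁻¹ * ∫⁻ y in S, h (f y / t) ≤ C * (μHE[m] (S ∩ {y | f y = 0}) + ε)

theorem exists_pos_forall_lt_abs {X : Type*} [TopologicalSpace X] {S : Set X} (hS : IsCompact S)
    {f : X → ℝ} (hf : Continuous f) (h0 : ∀ y ∈ S, f y ≠ 0) : ∃ c > 0, ∀ y ∈ S, c < |f y| := by
  rcases S.eq_empty_or_nonempty with rfl | hne
  · exact ⟨1, one_pos, by simp⟩
  obtain ⟨x, hx, hmin⟩ := hS.exists_isMinOn hne hf.abs.continuousOn
  have hpos := abs_pos.2 (h0 x hx)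
  exact ⟨|f x| / 2, by positivity, fun y hy => by
    have : |f x| ≤ |f y| := hmin hy
    linarith⟩

section
variable {m : ℕ} {f : Rn (m + 1) → ℝ} {h : ℝ → ℝ≥0∞} {C : ℝ≥0∞} {η : ℝ}

/-- By compactness `|f|` is bounded below on `S`, so for small `t` no value `f y / t` lies in `(0,
η)` and the integral vanishes. -/
theorem LayerBound.of_ne_zero (hf : Continuous f) (hη : ∀ r, r ∉ Ioo 0 η → h r = 0)
    {S : Set (Rn (m + 1))} (hS : IsCompact S) (h0 : ∀ y ∈ S, f y ≠ 0) : LayerBound f h C S := by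
  intro ε _
  obtain ⟨c, hc, hlt⟩ := exists_pos_forall_lt_abs hS hf h0
  have hev : ∀ᶠ t in 𝓝[>] (0 : ℝ), t * (|η| + 1) < c := by
    have : Tendsto (fun t : ℝ => t * (|η| + 1)) (𝓝[>] 0) (𝓝 (0 * (|η| + 1))) :=
      (tendsto_nhdsWithin_of_tendsto_nhds tendsto_id).mul_const _
    rw [zero_mul] at this
    exact this.eventually_lt_const hc
  filter_upwards [hev, self_mem_nhdsWithin] with t ht ht0
  have ht0 : 0 < t := ht0
  rw [setLIntegral_congr_fun hS.measurableSet (g := fun _ => 0), lintegral_zero, mul_zero]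
  · exact bot_le
  · intro y hy
    apply hη
    rintro ⟨h1, h2⟩
    have h3 := hlt y hy
    rw [div_lt_iff₀ ht0] at h2
    have h4 : 0 < f y := by
      by_contra hcon
      exact absurd h1 (not_lt.2 (div_nonpos_of_nonpos_of_nonneg (not_lt.1 hcon) ht0.le))
    rw [abs_of_pos h4] at h3
    nlinarith [le_abs_self η]

/-- Integrals are subadditive, but areas must add up without double counting; this is why the
overlap has to be negligible on the zero set. -/
theorem LayerBound.union {S₁ S₂ S : Set (Rn (m + 1))} (h₁ : LayerBound f h C S₁)
    (h₂ : LayerBound f h C S₂) (hS : S = S₁ ∪ S₂) (hf : Continuous f)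
    (hm₂ : IsClosed S₂) (hnull : μHE[m] (S₁ ∩ S₂ ∩ {y | f y = 0}) = 0) :
    LayerBound f h C S := by
  intro ε hε
  have hε2 : ε / 2 ≠ 0 := (ENNReal.half_pos hε).ne'
  filter_upwards [h₁ _ hε2, h₂ _ hε2] with t ht₁ ht₂
  have hZ : IsClosed {y | f y = 0} := isClosed_singleton.preimage hf
  have hadd : μHE[m] (S₁ ∩ {y | f y = 0}) + μHE[m] (S₂ ∩ {y | f y = 0}) ≤
      μHE[m] (S ∩ {y | f y = 0}) := by
    rw [← measure_union₀ (hm₂.inter hZ).measurableSet.nullMeasurableSet]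
    · refine measure_mono ?_
      rw [hS, union_inter_distrib_right]
    · refine measure_mono_null ?_ hnull
      exact fun y hy => ⟨⟨hy.1.1, hy.2.1⟩, hy.1.2⟩
  calc _ ≤ ENNReal.ofReal t⁻¹ * ((∫⁻ y in S₁, h (f y / t)) + ∫⁻ y in S₂, h (f y / t)) := by
        rw [hS]
        gcongr
        exact lintegral_union_le _ _ _
    _ ≤ C * (μHE[m] (S₁ ∩ {y | f y = 0}) + ε / 2) + C * (μHE[m] (S₂ ∩ {y | f y = 0}) + ε / 2) := by
        rw [mul_add]; exact add_le_add ht₁ ht₂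
    _ = C * (μHE[m] (S₁ ∩ {y | f y = 0}) + μHE[m] (S₂ ∩ {y | f y = 0}) + (ε / 2 + ε / 2)) := by
        ring
    _ ≤ _ := by
        rw [ENNReal.add_halves]
        gcongr

/-- The layer bound near a point of the zero set. -/
theorem exists_nhds_layerBound {L : Rn (m + 1) →L[ℝ] ℝ} {z : Rn (m + 1)}
    (hfc : Continuous f) (hf : HasStrictFDerivAt f L z) {κ : ℝ} (hκ : 0 < κ) (hL : κ⁻¹ < ‖L‖)
    (hh : Measurable h) (hη : ∀ r, r ∉ Ioo 0 η → h r = 0) :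
    ∃ s ∈ 𝓝 z, ∀ S ⊆ s, IsCompact S → LayerBound f h (ENNReal.ofReal κ * ∫⁻ r, h r) S := by
  have hb : 0 < ‖L‖ := (inv_pos.2 hκ).trans hL
  set b := ‖L‖ with hbdef
  -- The hypothesis `κ⁻¹ < b` makes `q < 1`. This value of `q` makes the final factor `t⁻¹ · q⁻¹ ·
  -- (b / t)⁻¹` exactly `κ`.
  set q : ℝ≥0 := ⟨κ⁻¹ / b, by positivity⟩ with hq
  have hq1 : q < 1 := by
    rw [← NNReal.coe_lt_coe]
    exact (div_lt_one hb).2 hL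
  have hq0 : q ≠ 0 := by
    rw [← NNReal.coe_ne_zero]
    exact (by positivity : (0 : ℝ) < κ⁻¹ / b).ne'
  obtain ⟨e, he, s, hs, Ψ, hΨ, hΨi, hvol, -⟩ := exists_straightening hf (norm_pos_iff.1 hb) hq1
  obtain ⟨T, hT⟩ := exists_isAxisCoord he
  have hΨc : Continuous Ψ := by
    have : Ψ = fun y => y + (f y / b - inner ℝ e y) • e := funext hΨ
    rw [this]
    fun_prop
  have hfst : ∀ y, (T (Ψ y)).1 = f y / b := fun y => by rw [hT.fst_eq, hΨi]
  have hsnd : ∀ y, (T (Ψ y)).2 = (T y).2 := fun y => by rw [hΨ, hT.snd_add_smul]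
  have hπ : Continuous fun y => (T y).2 := continuous_snd.comp hT.continuous
  refine ⟨s, hs, fun S hSs hS ε hε => ?_⟩
  -- the slices
  set Sl : ℝ → Set (Rn m) := fun τ => (fun y => (T y).2) '' (S ∩ {y | f y = b * τ}) with hSl
  have hSl0 : volume (Sl 0) ≤ μHE[m] (S ∩ {y | f y = 0}) := by
    rw [← EuclideanSpace.euclideanHausdorffMeasure_eq_volume]
    have := (hT.lipschitzWith_snd.lipschitzOnWith (s := S ∩ {y | f y = b * 0})
      ).euclideanHausdorffMeasure_image_le m
    rw [ENNReal.coe_one, one_pow, one_mul] at this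
    rw [hSl]
    simpa only [mul_zero] using this
  have hSlc : IsCompact (Sl 0) := (hS.inter_right (isClosed_eq hfc continuous_const)).image hπ
  -- Slices are upper semicontinuous in volume: the compact slice at height `0` has an open
  -- neighbourhood `U` of almost the same volume, and points of `S` projecting outside `U` have
  -- `|f|` bounded away from zero, so the slices at small heights lie in `U`.
  obtain ⟨U, hU0, hU, hUv⟩ := (Sl 0).exists_isOpen_lt_add (μ := volume) hSlc.measure_lt_top.ne hε
  obtain ⟨c, hc, hlt⟩ := exists_pos_forall_lt_abs (hS.diff (hU.preimage hπ)) hfc (by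
    intro y hy h0
    exact hy.2 (hU0 ⟨y, ⟨hy.1, by simpa using h0⟩, rfl⟩))
  have hslice : ∀ τ, 0 < τ → b * τ < c → volume (Sl τ) ≤ μHE[m] (S ∩ {y | f y = 0}) + ε := by
    intro τ hτ0 hτ
    have : Sl τ ⊆ U := by
      rintro _ ⟨y, ⟨hyS, hy⟩, rfl⟩
      by_contra hcon
      have h3 := hlt y ⟨hyS, hcon⟩
      have hy : f y = b * τ := hy
      rw [hy, abs_of_pos (by positivity)] at h3
      linarith
    exact (measure_mono this).trans (hUv.le.trans (by gcongr))
  have hev : ∀ᶠ t in 𝓝[>] (0 : ℝ), t * η < c := by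
    have : Tendsto (fun t : ℝ => t * η) (𝓝[>] 0) (𝓝 (0 * η)) :=
      (tendsto_nhdsWithin_of_tendsto_nhds tendsto_id).mul_const _
    rw [zero_mul] at this
    exact this.eventually_lt_const hc
  filter_upwards [hev, self_mem_nhdsWithin] with t ht ht0
  have ht0 : 0 < t := ht0
  set R : Set (ℝ × Rn m) := T '' (Ψ '' S) with hR
  have hRc : IsCompact R := (hS.image hΨc).image hT.continuous
  -- transport to the straightened picture
  have hmap : Measure.map (fun y => T (Ψ y)) (volume.restrict S) ≤
      (q : ℝ≥0∞)⁻¹ • volume.restrict R := by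
    have hTΨ : Measurable fun y => T (Ψ y) := (hT.continuous.comp hΨc).measurable
    refine Measure.le_iff.2 fun B hB => ?_
    rw [Measure.map_apply hTΨ hB, Measure.restrict_apply (hTΨ hB), Measure.smul_apply,
      Measure.restrict_apply hB, smul_eq_mul]
    have h1 := hvol ((fun y => T (Ψ y)) ⁻¹' B ∩ S) (inter_subset_right.trans hSs)
    have h2 : Ψ '' ((fun y => T (Ψ y)) ⁻¹' B ∩ S) ⊆ T ⁻¹' (B ∩ R) := by
      rintro _ ⟨y, ⟨hyB, hyS⟩, rfl⟩
      exact ⟨hyB, _, ⟨y, hyS, rfl⟩, rfl⟩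
    have h3 := measure_mono (μ := volume) h2
    rw [hT.measurePreserving.measure_preimage
      (hB.inter hRc.measurableSet).nullMeasurableSet] at h3
    rw [← ENNReal.mul_le_iff_le_inv (by simpa using hq0) ENNReal.coe_ne_top]
    exact h1.trans h3
  have hhm : Measurable fun p : ℝ × Rn m => h (b * t⁻¹ * p.1) :=
    hh.comp (measurable_fst.const_mul _)
  have hstep : ∫⁻ y in S, h (f y / t) ≤
      (q : ℝ≥0∞)⁻¹ * ∫⁻ p in R, h (b * t⁻¹ * p.1) := by
    have e1 : ∀ y, h (f y / t) = (fun p : ℝ × Rn m => h (b * t⁻¹ * p.1)) (T (Ψ y)) := by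
      intro y
      simp only [hfst]
      congr 1
      field_simp
    simp_rw [e1]
    have hTΨ : Measurable fun y => T (Ψ y) := (hT.continuous.comp hΨc).measurable
    rw [← lintegral_map hhm hTΨ]
    refine (lintegral_mono' hmap le_rfl).trans_eq ?_
    rw [lintegral_smul_measure, smul_eq_mul]
  set M := μHE[m] (S ∩ {y | f y = 0}) + ε with hM
  have hfub : ∫⁻ p in R, h (b * t⁻¹ * p.1) ≤ (ENNReal.ofReal (b * t⁻¹)⁻¹ * ∫⁻ r, h r) * M := by
    rw [← lintegral_indicator hRc.measurableSet, Measure.volume_eq_prod,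
      lintegral_prod _ (hhm.indicator hRc.measurableSet).aemeasurable,
      ← lintegral_comp_mul_left_real hh (by positivity), ← lintegral_mul_const]
    · refine lintegral_mono fun τ => ?_
      by_cases hτ : b * t⁻¹ * τ ∈ Ioo 0 η
      · have hτ0 : 0 < τ := pos_of_mul_pos_right hτ.1 (by positivity)
        have hτ1 : b * τ < c := by
          have := hτ.2
          rw [mul_comm b, mul_assoc, inv_mul_lt_iff₀ ht0] at this
          linarith
        calc _ ≤ ∫⁻ x, (Sl τ).indicator (fun _ => h (b * t⁻¹ * τ)) x := by
              refine lintegral_mono fun x => ?_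
              by_cases hx : (τ, x) ∈ R
              · have hx' : x ∈ Sl τ := by
                  obtain ⟨_, ⟨y, hy, rfl⟩, hyx⟩ := hx
                  refine ⟨y, ⟨hy, ?_⟩, ?_⟩
                  · have := hfst y
                    rw [hyx, eq_div_iff hb.ne'] at this
                    rw [mem_ofPred_eq, ← this, mul_comm]
                  · have := hsnd y
                    rw [hyx] at this
                    exact this.symm
                rw [indicator_of_mem hx, indicator_of_mem hx']
              · rw [indicator_of_notMem hx]; exact bot_le
          _ ≤ h (b * t⁻¹ * τ) * volume (Sl τ) := lintegral_indicator_const_le _ _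
          _ ≤ _ := by gcongr; exact hslice τ hτ0 hτ1
      · simp [indicator, hη _ hτ]
    · exact hh.comp (measurable_const_mul _)
  calc ENNReal.ofReal t⁻¹ * ∫⁻ y in S, h (f y / t)
      ≤ ENNReal.ofReal t⁻¹ *
        ((q : ℝ≥0∞)⁻¹ * ((ENNReal.ofReal (b * t⁻¹)⁻¹ * ∫⁻ r, h r) * M)) := by
        gcongr
        exact hstep.trans (by gcongr)
    _ = (ENNReal.ofReal t⁻¹ * (q : ℝ≥0∞)⁻¹ * ENNReal.ofReal (b * t⁻¹)⁻¹) * (∫⁻ r, h r) * M := by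
        ring
    _ = _ := by
        congr 2
        have hqr : (q : ℝ≥0∞)⁻¹ = ENNReal.ofReal (κ⁻¹ / b)⁻¹ := by
          rw [ENNReal.ofReal_inv_of_pos (by positivity), ENNReal.ofReal, hq]
          congr 2
          exact (Real.toNNReal_of_nonneg _).symm
        rw [hqr, ← ENNReal.ofReal_mul (by positivity), ← ENNReal.ofReal_mul (by positivity)]
        congr 1
        field_simp

/-- The layer bound on a compact set all of whose zeros are regular. -/
theorem layerBound_of_isCompact (hfd : ContDiff ℝ 1 f) {K : Set (Rn (m + 1))} (hK : IsCompact K)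
    {κ : ℝ} (hκ : 0 < κ) (hreg : ∀ y ∈ K, f y = 0 → κ⁻¹ < ‖fderiv ℝ f y‖)
    (hh : Measurable h) (hη : ∀ r, r ∉ Ioo 0 η → h r = 0) :
    LayerBound f h (ENNReal.ofReal κ * ∫⁻ r, h r) K := by
  have hfc := hfd.continuous
  set Z := {y | f y = 0} with hZ
  have hZc : IsClosed Z := isClosed_singleton.preimage hfc
  have hstrict : ∀ y, HasStrictFDerivAt f (fderiv ℝ f y) y := fun y =>
    hfd.contDiffAt.hasStrictFDerivAt (by norm_num)
  -- finiteness of the area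
  have hfin : μHE[m] (K ∩ Z) < ⊤ := by
    refine (hK.inter_right hZc).measure_lt_top_of_nhdsWithin fun y hy => ?_
    obtain ⟨s, hs, -, hfin⟩ := exists_nhds_levelSet_null (hstrict y)
      (norm_pos_iff.1 ((inv_pos.2 hκ).trans (hreg y hy.1 hy.2)))
    refine ⟨s ∩ Z, ?_, hfin⟩
    exact inter_mem (nhdsWithin_le_nhds hs) (mem_of_superset self_mem_nhdsWithin inter_subset_right)
  have : IsFiniteMeasure (μHE[m].restrict (K ∩ Z)) := ⟨by simpa using hfin⟩
  -- good balls
  have hball : ∀ y ∈ K, ∃ r > 0, (∀ S ⊆ Metric.closedBall y r, S ⊆ K → IsCompact S →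
      LayerBound f h (ENNReal.ofReal κ * ∫⁻ r, h r) S) ∧
      μHE[m] (frontier (Metric.ball y r) ∩ (K ∩ Z)) = 0 := by
    intro y hy
    obtain ⟨s, hs, hS⟩ : ∃ s ∈ 𝓝 y, ∀ S ⊆ s, S ⊆ K → IsCompact S →
        LayerBound f h (ENNReal.ofReal κ * ∫⁻ r, h r) S := by
      by_cases hy0 : f y = 0
      · obtain ⟨s, hs, h1⟩ := exists_nhds_layerBound hfc (hstrict y) hκ (hreg y hy hy0) hh hη
        exact ⟨s, hs, fun S hSs _ hS => h1 S hSs hS⟩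
      · exact ⟨{y | f y ≠ 0}, (isOpen_ne.preimage hfc).mem_nhds hy0, fun S hSs _ hS =>
          LayerBound.of_ne_zero hfc hη hS hSs⟩
    obtain ⟨R, hR, hRs⟩ := Metric.nhds_basis_closedBall.mem_iff.1 hs
    -- The zero set in `K` has finite area, so a radius can be chosen whose sphere meets it in a
    -- null set. Cutting along such spheres produces negligible overlaps.
    obtain ⟨r, hr, hr0⟩ := exists_null_frontier_thickening (μHE[m].restrict (K ∩ Z)) {y} hR
    refine ⟨r, hr.1, fun S hSr hSK hSc => hS S (hSr.trans
      ((Metric.closedBall_subset_closedBall hr.2.le).trans hRs)) hSK hSc, ?_⟩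
    rwa [Metric.thickening_singleton, Measure.restrict_apply isClosed_frontier.measurableSet] at hr0
  choose! r hr0 hrS hrn using hball
  obtain ⟨t, htK, htc⟩ := hK.elim_nhds_subcover (fun y => Metric.ball y (r y))
    (fun y hy => Metric.ball_mem_nhds y (hr0 y hy))
  have key : ∀ t : Finset (Rn (m + 1)), (∀ y ∈ t, y ∈ K) → ∀ S ⊆ K, IsCompact S →
      S ⊆ ⋃ y ∈ t, Metric.ball y (r y) → LayerBound f h (ENNReal.ofReal κ * ∫⁻ r, h r) S := by
    classical
    intro t
    induction t using Finset.induction_on with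
    | empty =>
      intro _ S _ hSc hS
      have hS : S = ∅ := by simpa using hS
      exact LayerBound.of_ne_zero hfc hη hSc (by simp [hS])
    | insert y t hyt ih =>
      intro hK' S hSK hSc hS
      have hyK := hK' y (Finset.mem_insert_self _ _)
      have h2c : IsCompact (S \ Metric.ball y (r y)) := hSc.diff Metric.isOpen_ball
      refine LayerBound.union (S₁ := S ∩ Metric.closedBall y (r y)) (S₂ := S \ Metric.ball y (r y))
        (hrS y hyK _ inter_subset_right (inter_subset_left.trans hSK)
          (hSc.inter_right Metric.isClosed_closedBall))
        (ih (fun x hx => hK' x (Finset.mem_insert_of_mem hx)) _ (sdiff_subset.trans hSK) h2c ?_)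
        ?_ hfc h2c.isClosed ?_
      · intro x hx
        have := hS hx.1
        rw [Finset.set_biUnion_insert] at this
        exact this.resolve_left hx.2
      · ext x
        by_cases hx : x ∈ Metric.ball y (r y)
        · simp [hx, Metric.ball_subset_closedBall hx]
        · simp only [mem_union, mem_inter_iff, Set.mem_sdiff]
          tauto
      · refine measure_mono_null ?_ (hrn y hyK)
        rintro x ⟨⟨⟨hxS, hx1⟩, -, hx2⟩, hxZ⟩
        refine ⟨?_, hSK hxS, hxZ⟩
        rw [frontier_ball y (hr0 y hyK).ne']
        simp only [Metric.mem_closedBall, Metric.mem_ball, not_lt, Metric.mem_sphere] at *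
        exact le_antisymm hx1 hx2
  exact key t htK K le_rfl hK htc

end

/-! ### Inward displacements of Lipschitz sets -/

/-- A bounded open set with Lipschitz boundary is pushed into itself, together with its closure, by
small displacements along a smooth compactly supported vector field. -/
theorem IsOpenLipschitz.exists_inward_field {n : ℕ} {B : Set (Rn n)} (hB : IsOpenLipschitz B)
    (hbdd : Bornology.IsBounded B) :
    ∃ X : Rn n → Rn n, ContDiff ℝ ∞ X ∧ HasCompactSupport X ∧
      ∀ᶠ ε in 𝓝[>] (0 : ℝ), ∀ y ∈ closure B, y + ε • X y ∈ B := by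
  classical
  have hfr : IsCompact (frontier B) :=
    Metric.isCompact_of_isClosed_isBounded isClosed_frontier
      (hbdd.closure.subset frontier_subset_closure)
  have hloc : ∀ x ∈ frontier B, ∃ (e : Rn n) (r : ℝ), ‖e‖ = 1 ∧ 0 < r ∧
      ∀ y ∈ closure B, ∀ t : ℝ, 0 < t → y ∈ Metric.ball x (3 * r) → y + t • e ∈ Metric.ball x (3 * r) →
        y + t • e ∈ B := by
    intro x hx
    obtain ⟨e, g, K, U, he, hg, hge, hU, hxU, hUB⟩ := hB.2 x hx
    obtain ⟨R, hR, hRU⟩ := Metric.isOpen_iff.1 hU x hxU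
    refine ⟨e, R / 3, he, by positivity, fun y hy t ht hyx htx => ?_⟩
    rw [mul_div_cancel₀ _ (three_ne_zero' ℝ)] at hyx htx
    rw [hUB _ (hRU htx), hge]
    -- On the closure only the weak inequality survives. Since `g` is constant along `e`, moving by
    -- `t > 0` makes it strict.
    have hle : g y ≤ inner ℝ y e := by
      have hcl : y ∈ closure (U ∩ B) := hU.inter_closure ⟨hRU hyx, hy⟩
      refine (closure_minimal ?_ (isClosed_le hg.continuous
        (continuous_id.inner continuous_const)) : closure (U ∩ B) ⊆ {y | g y ≤ inner ℝ y e}) hcl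
      exact fun w hw => ((hUB w hw.1).1 hw.2).le
    rw [inner_add_left, inner_smul_left, real_inner_self_eq_norm_sq, he]
    simp
    linarith
  choose! e r he hr hpush using hloc
  obtain ⟨t, htB, htc⟩ := hfr.elim_nhds_subcover (fun x => Metric.ball x (r x))
    (fun x hx => Metric.ball_mem_nhds x (hr x hx))
  -- The bump is positive exactly on the ball of radius `2 r`, and the total displacement is less
  -- than `r`, so all intermediate points remain in the ball of radius `3 r` where pushing along `e`
  -- is safe.
  let f : ∀ x : t, ContDiffBump (x : Rn n) := fun x =>
    ⟨r x, 2 * r x, hr x (htB x x.2), by linarith [hr x (htB x x.2)]⟩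
  let X : Finset t → Rn n → Rn n := fun s y => ∑ x ∈ s, f x y • e x
  have hXn : ∀ s y, ‖X s y‖ ≤ t.card := by
    intro s y
    calc ‖X s y‖ ≤ ∑ x ∈ s, ‖f x y • e x‖ := norm_sum_le _ _
      _ ≤ ∑ x ∈ s, 1 := by
          refine Finset.sum_le_sum fun x _ => ?_
          rw [norm_smul, he x (htB x x.2), mul_one, Real.norm_eq_abs, abs_of_nonneg (f x).nonneg]
          exact (f x).le_one
      _ ≤ t.card := by
          rw [Finset.sum_const, nsmul_one]
          exact_mod_cast (Finset.card_le_univ s).trans_eq (Fintype.card_coe t)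
  refine ⟨X Finset.univ, ?_, ?_, ?_⟩
  · exact ContDiff.sum fun x _ => (f x).contDiff.smul contDiff_const
  · have : HasCompactSupport (∑ x : t, fun y => f x y • e x) := by
      refine Finset.sum_induction _ HasCompactSupport (fun a b ha hb => ha.add hb)
        HasCompactSupport.zero fun x _ => ?_
      exact (f x).hasCompactSupport.smul_right
    convert this using 1
    ext1 y
    simp [X]
  · have hsmall : ∀ᶠ ε in 𝓝[>] (0 : ℝ), ∀ x ∈ t, ε * t.card < r x := by
      rw [Filter.eventually_all_finset]
      intro x hx
      have : Tendsto (fun ε : ℝ => ε * t.card) (𝓝[>] 0) (𝓝 (0 * t.card)) :=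
        (tendsto_nhdsWithin_of_tendsto_nhds tendsto_id).mul_const _
      rw [zero_mul] at this
      exact this.eventually_lt_const (hr x (htB x hx))
    filter_upwards [hsmall, self_mem_nhdsWithin] with ε hε hε0 y hy
    have hε0 : 0 < ε := hε0
    have hnear : ∀ s (x : t), 0 < f x y → y + ε • X s y ∈ Metric.ball (x : Rn n) (3 * r x) := by
      intro s x hx
      have h1 : y ∈ Metric.ball (x : Rn n) (2 * r x) := by
        have : y ∈ Function.support (f x) := hx.ne'
        rwa [(f x).support_eq] at this
      rw [Metric.mem_ball, dist_eq_norm] at h1 ⊢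
      calc ‖y + ε • X s y - x‖ = ‖(y - x) + ε • X s y‖ := by congr 1; abel
        _ ≤ ‖y - x‖ + ‖ε • X s y‖ := norm_add_le _ _
        _ < 2 * r x + r x := by
            refine add_lt_add_of_lt_of_le h1 ?_
            rw [norm_smul, Real.norm_of_nonneg hε0.le]
            exact (mul_le_mul_of_nonneg_left (hXn s y) hε0.le).trans (hε x x.2).le
        _ = 3 * r x := by ring
    -- The displacement is performed one bump at a time. Each push keeps the point in `closure B`,
    -- and a push of positive length puts it in `B`, where later pushes leave it. Points met by no
    -- bump are not on the frontier.
    have key : ∀ s : Finset t, y + ε • X s y ∈ closure B ∧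
        ((∃ x ∈ s, 0 < f x y) → y + ε • X s y ∈ B) := by
      intro s
      induction s using Finset.induction_on with
      | empty => simpa [X] using hy
      | insert x s hxs ih =>
        have hins : y + ε • X (insert x s) y = (y + ε • X s y) + (ε * f x y) • e x := by
          simp only [X, Finset.sum_insert hxs, smul_add, smul_smul]
          abel
        have hnn : 0 ≤ f x y := (f x).nonneg
        rcases eq_or_lt_of_le hnn with h0 | h0
        · rw [hins, ← h0, mul_zero, zero_smul, add_zero]
          refine ⟨ih.1, fun ⟨x', hx', hpos⟩ => ih.2 ⟨x', ?_, hpos⟩⟩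
          refine (Finset.mem_insert.1 hx').resolve_left fun h => ?_
          rw [h, ← h0] at hpos
          exact lt_irrefl _ hpos
        · have hmem : y + ε • X (insert x s) y ∈ B := by
            have h1 := hnear s x h0
            have h2 := hnear (insert x s) x h0
            rw [hins] at h2 ⊢
            exact hpush x (htB x x.2) _ ih.1 _ (mul_pos hε0 h0) h1 h2
          exact ⟨subset_closure hmem, fun _ => hmem⟩
    by_cases hex : ∃ x : t, 0 < f x y
    · obtain ⟨x, hx⟩ := hex
      exact (key Finset.univ).2 ⟨x, Finset.mem_univ x, hx⟩
    · have hz : X Finset.univ y = 0 := by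
        refine Finset.sum_eq_zero fun x _ => ?_
        have : f x y = 0 := le_antisymm (not_lt.1 fun h => hex ⟨x, h⟩) (f x).nonneg
        rw [this, zero_smul]
      rw [hz, smul_zero, add_zero]
      by_contra hyB
      have hyf : y ∈ frontier B := by
        rw [hB.1.frontier_eq]
        exact ⟨hy, hyB⟩
      obtain ⟨x, hxt, hyx⟩ := mem_iUnion₂.1 (htc hyf)
      refine hex ⟨⟨x, hxt⟩, (f ⟨x, hxt⟩).pos_of_mem_ball ?_⟩
      refine Metric.ball_subset_ball ?_ hyx
      change r x ≤ 2 * r x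
      linarith [hr x (htB x hxt)]

/-! ### Sides of a regular zero set -/

section
variable {V : Type*} [NormedAddCommGroup V] [InnerProductSpace ℝ V]

theorem eventually_pos_of_hasFDerivAt {f : V → ℝ} {L : V →L[ℝ] ℝ} {x v : V}
    (hf : HasFDerivAt f L x) (h0 : f x = 0) (hv : 0 < L v) :
    ∀ᶠ t in 𝓝[>] (0 : ℝ), 0 < f (x + t • v) := by
  have hd : HasDerivAt (fun t : ℝ => f (x + t • v)) (L v) 0 := hf.hasLineDerivAt v
  have := hd.tendsto_slope_zero_right
  simp only [zero_add, zero_smul, add_zero, h0, sub_zero, smul_eq_mul] at this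
  filter_upwards [this.eventually_const_lt hv, self_mem_nhdsWithin] with t ht ht0
  exact pos_of_mul_pos_right ht (inv_nonneg.2 (le_of_lt ht0))

theorem eventually_neg_of_hasFDerivAt {f : V → ℝ} {L : V →L[ℝ] ℝ} {x v : V}
    (hf : HasFDerivAt f L x) (h0 : f x = 0) (hv : L v < 0) :
    ∀ᶠ t in 𝓝[>] (0 : ℝ), f (x + t • v) < 0 := by
  have := eventually_pos_of_hasFDerivAt (v := v) hf.neg (by simp [h0]) (by simpa using hv)
  simpa using this

/-- Functions with unit gradients and the same sign near a common zero have the same gradient. -/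
theorem fderiv_eq_of_same_sign [CompleteSpace V] {f g : V → ℝ} {L L' : V →L[ℝ] ℝ} {x : V} (hf : HasFDerivAt f L x)
    (hg : HasFDerivAt g L' x) (hf0 : f x = 0) (hg0 : g x = 0) (hL : ‖L‖ = 1) (hL' : ‖L'‖ = 1)
    (hs : ∀ᶠ y in 𝓝 x, 0 < f y → 0 < g y) : L = L' := by
  set a := (InnerProductSpace.toDual ℝ V).symm L with ha
  set b := (InnerProductSpace.toDual ℝ V).symm L' with hb
  have han : ‖a‖ = 1 := by rw [ha, LinearIsometryEquiv.norm_map, hL]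
  have hbn : ‖b‖ = 1 := by rw [hb, LinearIsometryEquiv.norm_map, hL']
  have hai : ∀ v, L v = inner ℝ a v := fun v => InnerProductSpace.toDual_symm_apply.symm
  have hbi : ∀ v, L' v = inner ℝ b v := fun v => InnerProductSpace.toDual_symm_apply.symm
  suffices hab : a = b from (InnerProductSpace.toDual ℝ V).symm.injective hab
  by_contra hne
  have hlt : inner ℝ a b < 1 := by
    refine lt_of_le_of_ne ?_ ?_
    · have := real_inner_le_norm a b
      rwa [han, hbn, one_mul] at this
    · intro h
      exact hne ((inner_eq_one_iff_of_norm_eq_one (𝕜 := ℝ) han hbn).1 h)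
  -- Moving in direction `a - b`, between distinct unit gradients, increases `f` and decreases `g`,
  -- contradicting the sign condition.
  have h1 : 0 < L (a - b) := by
    rw [hai, inner_sub_right, real_inner_self_eq_norm_sq, han]; linarith
  have h2 : L' (a - b) < 0 := by
    rw [hbi, inner_sub_right, real_inner_self_eq_norm_sq, hbn, real_inner_comm]; linarith
  have htend : Tendsto (fun t : ℝ => x + t • (a - b)) (𝓝[>] 0) (𝓝 x) := by
    have : Tendsto (fun t : ℝ => x + t • (a - b)) (𝓝 0) (𝓝 (x + (0 : ℝ) • (a - b))) :=
      (by fun_prop : Continuous fun t : ℝ => x + t • (a - b)).tendsto 0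
    rw [zero_smul, add_zero] at this
    exact tendsto_nhdsWithin_of_tendsto_nhds this
  obtain ⟨t, ⟨ht1, ht2⟩, ht3⟩ := (((eventually_pos_of_hasFDerivAt hf hf0 h1).and
    (eventually_neg_of_hasFDerivAt hg hg0 h2)).and (htend.eventually hs)).exists
  exact absurd (ht3 ht1) (not_lt.2 ht2.le)

theorem frequently_neg_of_fderiv_ne_zero {f : V → ℝ} {x : V} (h0 : f x = 0)
    (hf : fderiv ℝ f x ≠ 0) : ∃ᶠ y in 𝓝 x, f y < 0 := by
  intro h
  refine hf (IsLocalMin.fderiv_eq_zero ?_)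
  filter_upwards [h] with y hy
  rw [h0]
  exact not_lt.1 hy

theorem inter_frontier_nonempty_of_isPreconnected {X : Type*} [TopologicalSpace X] {S E : Set X}
    (hS : IsPreconnected S) (h1 : (S ∩ E).Nonempty) (h2 : (S ∩ Eᶜ).Nonempty) :
    (S ∩ frontier E).Nonempty := by
  by_contra hcon
  have hno : ∀ y ∈ S, y ∉ frontier E := fun y hy hyf => hcon ⟨y, hy, hyf⟩
  have hin : ∀ y ∈ S, y ∈ E → y ∈ interior E := fun y hy hyE => by
    by_contra hn
    exact hno y hy ⟨subset_closure hyE, hn⟩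
  have hout : ∀ y ∈ S, y ∈ Eᶜ → y ∈ interior Eᶜ := fun y hy hyE => by
    by_contra hn
    rw [interior_compl, notMem_compl_iff] at hn
    exact hno y hy ⟨hn, fun h => hyE (interior_subset h)⟩
  obtain ⟨y, -, hy1, hy2⟩ := hS (interior E) (interior Eᶜ) isOpen_interior isOpen_interior
    (fun y hy => (em (y ∈ E)).imp (hin y hy) (hout y hy))
    (h1.imp fun y hy => ⟨hy.1, hin y hy.1 hy.2⟩) (h2.imp fun y hy => ⟨hy.1, hout y hy.1 hy.2⟩)
  exact interior_subset hy2 (interior_subset hy1)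

/-- If the boundary of `E` is the zero set of `f` near a regular point, then locally the set
`{f > 0}` is either contained in `E` or disjoint from it. -/
theorem exists_nhds_constant_side [CompleteSpace V] {E : Set V} {f : V → ℝ} {L : V →L[ℝ] ℝ} {x : V}
    (hf : HasStrictFDerivAt f L x) (hL : L ≠ 0) (h0 : f x = 0) {U : Set V} (hU : U ∈ 𝓝 x)
    (hfr : ∀ y ∈ U, y ∈ frontier E → f y = 0) :
    ∃ W ∈ 𝓝 x, (∀ y ∈ W, 0 < f y → y ∈ E) ∨ (∀ y ∈ W, 0 < f y → y ∉ E) := by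
  have hc : 0 < ‖L‖ := norm_pos_iff.2 hL
  set c := ‖L‖ with hcdef
  set g := (InnerProductSpace.toDual ℝ V).symm L with hg
  have hgn : ‖g‖ = c := by rw [hg, LinearIsometryEquiv.norm_map]
  set e := c⁻¹ • g with he
  have hen : ‖e‖ = 1 := by
    rw [he, norm_smul, hgn, norm_inv, Real.norm_of_nonneg hc.le, inv_mul_cancel₀ hc.ne']
  have hLe : L e = c := by
    have : L e = inner ℝ g e := InnerProductSpace.toDual_symm_apply.symm
    rw [this, he, inner_smul_right, real_inner_self_eq_norm_sq, hgn]
    field_simp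
  -- With error at most `c / 4`, moving along `e` increases `f` at rate at least `3c / 4`. A lift by
  -- `τ` from the ball of radius `τ / 4` ends with `f ≥ c τ (1 - 1/4 - 5/16) > 0`. Hence any two
  -- points of `{f > 0}` in the small ball are joined inside `{f > 0}` by going up, across the
  -- translated ball, and down.
  obtain ⟨s, hs, happ⟩ := hf.approximates_deriv_on_nhds (c := (c / 4).toNNReal)
    (Or.inr (Real.toNNReal_pos.2 (by positivity)))
  obtain ⟨r, hr, hrs⟩ := Metric.mem_nhds_iff.1 (inter_mem hs hU)
  have happ' : ∀ y ∈ Metric.ball x r, ∀ y' ∈ Metric.ball x r,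
      |f y - f y' - L (y - y')| ≤ c / 4 * ‖y - y'‖ := fun y hy y' hy' => by
    have := happ y (hrs hy).1 y' (hrs hy').1
    rwa [Real.coe_toNNReal _ (by positivity)] at this
  set τ := r / 2 with hτ
  have hτ0 : 0 < τ := by positivity
  -- points of the small ball, lifted along the normal
  have hball : ∀ y ∈ Metric.ball x (τ / 4), ∀ θ ∈ Icc 0 τ, y + θ • e ∈ Metric.ball x r := by
    intro y hy θ hθ
    rw [Metric.mem_ball, dist_eq_norm] at hy ⊢
    calc ‖y + θ • e - x‖ = ‖(y - x) + θ • e‖ := by congr 1; abel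
      _ ≤ ‖y - x‖ + ‖θ • e‖ := norm_add_le _ _
      _ < τ / 4 + τ := by
          refine add_lt_add_of_lt_of_le hy ?_
          rw [norm_smul, hen, mul_one, Real.norm_of_nonneg hθ.1]
          exact hθ.2
      _ ≤ r := by rw [hτ]; linarith
  have htop : ∀ y ∈ Metric.ball x (τ / 4), 0 < f (y + τ • e) := by
    intro y hy
    have h1 := happ' _ (hball y hy τ ⟨hτ0.le, le_rfl⟩) x (Metric.mem_ball_self hr)
    rw [Metric.mem_ball, dist_eq_norm] at hy
    have h2 : y + τ • e - x = (y - x) + τ • e := by abel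
    have h3 : ‖y + τ • e - x‖ ≤ τ / 4 + τ := by
      rw [h2]
      refine (norm_add_le _ _).trans (add_le_add hy.le ?_)
      rw [norm_smul, hen, mul_one, Real.norm_of_nonneg hτ0.le]
    have h4 : |L (y - x)| ≤ c * (τ / 4) :=
      (L.le_opNorm _).trans (mul_le_mul_of_nonneg_left hy.le hc.le)
    have h5 : L (y + τ • e - x) = L (y - x) + τ * c := by
      rw [h2, map_add, map_smul, hLe, smul_eq_mul]
    rw [h0, sub_zero, h5, abs_le] at h1
    rw [abs_le] at h4
    nlinarith [mul_pos hc hτ0]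
  have hvert : ∀ y ∈ Metric.ball x (τ / 4), 0 < f y → ∀ θ ∈ Icc 0 τ, 0 < f (y + θ • e) := by
    intro y hy hfy θ hθ
    have h1 := happ' _ (hball y hy θ hθ) y
      (by simpa using hball y hy 0 ⟨le_rfl, hτ0.le⟩)
    rw [add_sub_cancel_left, norm_smul, hen, mul_one, Real.norm_of_nonneg hθ.1, map_smul, hLe,
      smul_eq_mul, abs_le] at h1
    nlinarith [mul_nonneg hc.le hθ.1, h1.1]
  refine ⟨Metric.ball x (τ / 4), Metric.ball_mem_nhds x (by positivity), ?_⟩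
  by_contra! hcon
  obtain ⟨⟨y₁, hy₁, hf₁, hn₁⟩, ⟨y₂, hy₂, hf₂, hn₂⟩⟩ := hcon
  -- a connected path avoiding the boundary
  set S₁ : Set V := (fun θ : ℝ => y₁ + θ • e) '' Icc 0 τ with hS₁
  set S₂ : Set V := (fun y : V => y + τ • e) '' Metric.ball x (τ / 4) with hS₂
  set S₃ : Set V := (fun θ : ℝ => y₂ + θ • e) '' Icc 0 τ with hS₃
  have c1 : IsPreconnected S₁ := isPreconnected_Icc.image _ (by fun_prop)
  have c2 : IsPreconnected S₂ :=
    (convex_ball x (τ / 4)).isPreconnected.image _ (by fun_prop)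
  have c3 : IsPreconnected S₃ := isPreconnected_Icc.image _ (by fun_prop)
  have hτI : τ ∈ Icc 0 τ := ⟨hτ0.le, le_rfl⟩
  have h0I : (0 : ℝ) ∈ Icc 0 τ := ⟨le_rfl, hτ0.le⟩
  have c12 : IsPreconnected (S₁ ∪ S₂) :=
    IsPreconnected.union (y₁ + τ • e) ⟨τ, hτI, rfl⟩ ⟨y₁, hy₁, rfl⟩ c1 c2
  have c123 : IsPreconnected (S₁ ∪ S₂ ∪ S₃) :=
    IsPreconnected.union (y₂ + τ • e) (Or.inr ⟨y₂, hy₂, rfl⟩) ⟨τ, hτI, rfl⟩ c12 c3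
  have hpos : ∀ y ∈ S₁ ∪ S₂ ∪ S₃, y ∈ Metric.ball x r ∧ 0 < f y := by
    rintro y ((⟨θ, hθ, rfl⟩ | ⟨w, hw, rfl⟩) | ⟨θ, hθ, rfl⟩)
    · exact ⟨hball y₁ hy₁ θ hθ, hvert y₁ hy₁ hf₁ θ hθ⟩
    · exact ⟨hball w hw τ hτI, htop w hw⟩
    · exact ⟨hball y₂ hy₂ θ hθ, hvert y₂ hy₂ hf₂ θ hθ⟩
  obtain ⟨y, hy, hyf⟩ := inter_frontier_nonempty_of_isPreconnected c123
    ⟨y₂, Or.inr ⟨0, h0I, by simp⟩, hn₂⟩ ⟨y₁, Or.inl (Or.inl ⟨0, h0I, by simp⟩), hn₁⟩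
  have := hpos y hy
  exact absurd (hfr y (hrs this.1).2 hyf) this.2.ne'

end

/-! ### Signed defining functions of a set with smooth boundary -/

section

open scoped Manifold

theorem notMem_of_frequently_compl {X : Type*} [TopologicalSpace X] {E : Set X} {y : X} (h : ∃ᶠ z in 𝓝 y, z ∈ interior Eᶜ) :
    y ∉ interior (closure E) := fun hy => by
  obtain ⟨z, hz, hz'⟩ := (h.and_eventually (isOpen_interior.mem_nhds hy)).exists
  rw [interior_compl] at hz
  exact hz (interior_subset hz')

section
variable {V : Type*} [NormedAddCommGroup V] [InnerProductSpace ℝ V]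

/-- In the open set `U`, the function `h` is positive inside `E` and negative outside of `E` (both
up to the boundary), and it has unit gradient at its zeros, which are boundary points. -/
structure IsSignedIn (E U : Set V) (h : V → ℝ) : Prop where
  isOpen : IsOpen U
  contDiffOn : ContDiffOn ℝ ∞ h U
  pos_iff : ∀ y ∈ U, 0 < h y ↔ y ∈ interior (closure E)
  neg_iff : ∀ y ∈ U, h y < 0 ↔ y ∈ interior (closure Eᶜ)
  norm_fderiv : ∀ y ∈ U, h y = 0 → ‖fderiv ℝ h y‖ = 1

theorem IsSignedIn.neg {E U : Set V} {h : V → ℝ} (hs : IsSignedIn E U h) :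
    IsSignedIn Eᶜ U fun y => -h y where
  isOpen := hs.isOpen
  contDiffOn := hs.contDiffOn.neg
  pos_iff y hy := by rw [neg_pos, hs.neg_iff y hy]
  neg_iff y hy := by rw [neg_lt_zero, hs.pos_iff y hy, compl_compl]
  norm_fderiv y hy h0 := by
    have := hs.norm_fderiv y hy (by simpa using h0)
    rw [fderiv_fun_neg, norm_neg, this]

theorem IsSignedIn.of_compl {E U : Set V} {h : V → ℝ} (hs : IsSignedIn Eᶜ U h) :
    IsSignedIn E U fun y => -h y := by
  have := hs.neg
  rwa [compl_compl] at this

/-- This serves the places without transition: interior points of `E`, and frontier sheets with `E`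
on both sides. Density of `interior E` makes such sheets belong to `interior (closure E)`. -/
theorem isSignedIn_one {E U : Set V} (hU : IsOpen U) (h : ∀ y ∈ U, y ∈ closure (U ∩ interior E)) :
    IsSignedIn E U fun _ => 1 where
  isOpen := hU
  contDiffOn := contDiffOn_const
  pos_iff y hy := by
    simp only [one_pos, true_iff]
    refine mem_interior.2 ⟨U, fun z hz => ?_, hU, hy⟩
    exact closure_mono (inter_subset_right.trans interior_subset) (h z hz)
  neg_iff y hy := by
    refine iff_of_false (by norm_num) ?_
    refine notMem_of_frequently_compl ?_
    rw [compl_compl]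
    exact (mem_closure_iff_frequently.1 (h y hy)).mono fun z hz => hz.2
  norm_fderiv y _ h0 := absurd h0 one_ne_zero

variable [CompleteSpace V]

/-- Division by `‖fderiv ℝ f y‖` keeps the sign and normalizes the gradient at zeros, because the
derivative of the denominator is multiplied by `f = 0`. A zero lies in neither open side, as both
signs of `f` occur arbitrarily close to it. -/
theorem isSignedIn_of_sides {E U : Set V} {f : V → ℝ} (hU : IsOpen U) (hf : ContDiffOn ℝ ∞ f U)
    (hd : ∀ y ∈ U, fderiv ℝ f y ≠ 0) (hpos : ∀ y ∈ U, 0 < f y → y ∈ E)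
    (hneg : ∀ y ∈ U, f y < 0 → y ∉ E) :
    IsSignedIn E U fun y => f y * ‖fderiv ℝ f y‖⁻¹ := by
  have hn : ∀ y ∈ U, 0 < ‖fderiv ℝ f y‖ := fun y hy => norm_pos_iff.2 (hd y hy)
  have hfc : ContinuousOn f U := hf.continuousOn
  have hposI : ∀ y ∈ U, 0 < f y → y ∈ interior E := fun y hy h0 =>
    mem_interior.2 ⟨U ∩ f ⁻¹' Ioi 0, fun z hz => hpos z hz.1 hz.2,
      hfc.isOpen_inter_preimage hU isOpen_Ioi, hy, h0⟩
  have hnegI : ∀ y ∈ U, f y < 0 → y ∈ interior Eᶜ := fun y hy h0 =>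
    mem_interior.2 ⟨U ∩ f ⁻¹' Iio 0, fun z hz => hneg z hz.1 hz.2,
      hfc.isOpen_inter_preimage hU isOpen_Iio, hy, h0⟩
  have hfrN : ∀ y ∈ U, f y = 0 → ∃ᶠ z in 𝓝 y, z ∈ interior Eᶜ := fun y hy h0 =>
    ((frequently_neg_of_fderiv_ne_zero h0 (hd y hy)).and_eventually (hU.mem_nhds hy)).mono
      fun z hz => hnegI z hz.2 hz.1
  have hfrP : ∀ y ∈ U, f y = 0 → ∃ᶠ z in 𝓝 y, z ∈ interior Eᶜᶜ := fun y hy h0 => by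
    have h1 := frequently_neg_of_fderiv_ne_zero (f := fun z => -f z) (x := y) (by simp [h0])
      (by rw [fderiv_fun_neg]; simpa using hd y hy)
    rw [compl_compl]
    exact (h1.and_eventually (hU.mem_nhds hy)).mono fun z hz =>
      hposI z hz.2 (by simpa using hz.1)
  have hnsm : ContDiffOn ℝ ∞ (fun y => ‖fderiv ℝ f y‖) U := by
    have h1 : ContDiffOn ℝ ∞ (fderiv ℝ f) U := hf.fderiv_of_isOpen hU (by simp)
    have h2 : ContDiffOn ℝ ∞ (fun y => (InnerProductSpace.toDual ℝ V).symm (fderiv ℝ f y)) U :=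
      (InnerProductSpace.toDual ℝ V).symm.contDiff.comp_contDiffOn h1
    have h3 := h2.norm ℝ (fun y hy => by simpa using hd y hy)
    simpa using h3
  have hinv : ContDiffOn ℝ ∞ (fun y => ‖fderiv ℝ f y‖⁻¹) U := hnsm.inv fun y hy => (hn y hy).ne'
  refine ⟨hU, hf.mul hinv, fun y hy => ?_, fun y hy => ?_, fun y hy h0 => ?_⟩
  · rw [mul_pos_iff_of_pos_right (inv_pos.2 (hn y hy))]
    refine ⟨fun h => interior_mono subset_closure (hposI y hy h), fun h => ?_⟩
    by_contra hcon
    rcases (not_lt.1 hcon).lt_or_eq with h1 | h1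
    · have := hnegI y hy h1
      rw [interior_compl] at this
      exact this (interior_subset h)
    · exact notMem_of_frequently_compl (hfrN y hy h1) h
  · rw [← neg_pos, ← neg_mul, mul_pos_iff_of_pos_right (inv_pos.2 (hn y hy)), neg_pos]
    refine ⟨fun h => interior_mono subset_closure (hnegI y hy h), fun h => ?_⟩
    by_contra hcon
    rcases (not_lt.1 hcon).lt_or_eq with h1 | h1
    · have := hposI y hy h1
      have h2 := interior_subset h
      rw [closure_compl] at h2
      exact h2 this
    · exact notMem_of_frequently_compl (hfrP y hy h1.symm) h
  · have hf0 : f y = 0 := (mul_eq_zero.1 h0).resolve_right (inv_pos.2 (hn y hy)).ne'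
    have h1 : HasFDerivAt f (fderiv ℝ f y) y :=
      ((hf.contDiffAt (hU.mem_nhds hy)).differentiableAt (by simp)).hasFDerivAt
    have h2 : DifferentiableAt ℝ (fun y => ‖fderiv ℝ f y‖⁻¹) y :=
      (hinv.contDiffAt (hU.mem_nhds hy)).differentiableAt (by simp)
    have h3 := h1.fun_mul h2.hasFDerivAt
    rw [h3.fderiv, hf0, zero_smul, zero_add, norm_smul, norm_inv, norm_norm,
      inv_mul_cancel₀ (hn y hy).ne']

/-- A set whose boundary is a smooth hypersurface near `x` has a signed function near `x`. -/
theorem exists_isSignedIn {E : Set V} {x : V}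
    (hx : x ∈ frontier E → ∃ (U : Set V) (f : V → ℝ), IsOpen U ∧ x ∈ U ∧ ContDiffOn ℝ ∞ f U ∧
      (∀ y ∈ U, fderiv ℝ f y ≠ 0) ∧ frontier E ∩ U = {y ∈ U | f y = 0}) :
    ∃ U h, x ∈ U ∧ IsSignedIn E U h := by
  have hinterior : ∀ F : Set V, IsSignedIn F (interior F) fun _ => 1 := fun F =>
    isSignedIn_one isOpen_interior fun y hy => subset_closure ⟨hy, hy⟩
  by_cases hfr : x ∈ frontier E
  · obtain ⟨U, f, hU, hxU, hf, hd, hzero⟩ := hx hfr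
    have h0 : f x = 0 := by
      have : x ∈ {y ∈ U | f y = 0} := hzero ▸ ⟨hfr, hxU⟩
      exact this.2
    have hfr' : ∀ y ∈ U, y ∈ frontier E → f y = 0 := fun y hy hyf => by
      have : y ∈ {y ∈ U | f y = 0} := hzero ▸ ⟨hyf, hy⟩
      exact this.2
    have hst : HasStrictFDerivAt f (fderiv ℝ f x) x :=
      (hf.contDiffAt (hU.mem_nhds hxU)).hasStrictFDerivAt (by simp)
    obtain ⟨W₁, hW₁, h₁⟩ := exists_nhds_constant_side hst (hd x hxU) h0 (hU.mem_nhds hxU) hfr'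
    obtain ⟨W₂, hW₂, h₂⟩ := exists_nhds_constant_side (f := fun y => -f y) (E := E) hst.neg
      (neg_ne_zero.2 (hd x hxU)) (by simp [h0]) (hU.mem_nhds hxU)
      (fun y hy hyf => by simp [hfr' y hy hyf])
    obtain ⟨W, hWs, hW, hxW⟩ := mem_nhds_iff.1 (inter_mem (inter_mem hW₁ hW₂) (hU.mem_nhds hxU))
    have hfW : ContDiffOn ℝ ∞ f W := hf.mono fun y hy => (hWs hy).2
    have hdW : ∀ y ∈ W, fderiv ℝ f y ≠ 0 := fun y hy => hd y (hWs hy).2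
    have hdense : ∀ F : Set V, (∀ y ∈ W, f y ≠ 0 → y ∈ F) → IsSignedIn F W fun _ => 1 := by
      intro F hF
      refine isSignedIn_one hW fun y hy => ?_
      have hmem : ∀ z ∈ W, f z ≠ 0 → z ∈ W ∩ interior F := fun z hz hz0 => ⟨hz, mem_interior.2
        ⟨W ∩ f ⁻¹' {0}ᶜ, fun w hw => hF w hw.1 hw.2,
          hfW.continuousOn.isOpen_inter_preimage hW isOpen_compl_singleton, hz, hz0⟩⟩
      by_cases hy0 : f y = 0
      · exact mem_closure_iff_frequently.2
          (((frequently_neg_of_fderiv_ne_zero hy0 (hdW y hy)).and_eventually (hW.mem_nhds hy)).mono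
            fun z hz => hmem z hz.2 hz.1.ne)
      · exact subset_closure (hmem y hy hy0)
    -- Each of the sets `{f > 0}` and `{f < 0}` is on one side. Equal sides give the constant `1` or
    -- `-1`; opposite sides give the normalized `f` up to sign.
    rcases h₁ with h₁ | h₁ <;> rcases h₂ with h₂ | h₂
    · exact ⟨W, _, hxW, hdense E fun y hy hy0 => hy0.lt_or_gt.elim
        (fun h => h₂ y (hWs hy).1.2 (by simpa using h)) (fun h => h₁ y (hWs hy).1.1 h)⟩
    · exact ⟨W, _, hxW, isSignedIn_of_sides hW hfW hdW (fun y hy h => h₁ y (hWs hy).1.1 h)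
        (fun y hy h => h₂ y (hWs hy).1.2 (by simpa using h))⟩
    · exact ⟨W, _, hxW, (isSignedIn_of_sides (E := Eᶜ) hW hfW hdW
        (fun y hy h => h₁ y (hWs hy).1.1 h)
        (fun y hy h => not_not.2 (h₂ y (hWs hy).1.2 (by simpa using h)))).of_compl⟩
    · exact ⟨W, _, hxW, (hdense Eᶜ fun y hy hy0 => hy0.lt_or_gt.elim
        (fun h => h₂ y (hWs hy).1.2 (by simpa using h))
        (fun h => h₁ y (hWs hy).1.1 h)).of_compl⟩
  · by_cases hxi : x ∈ interior E
    · exact ⟨_, _, hxi, hinterior E⟩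
    · refine ⟨_, _, ?_, (hinterior Eᶜ).of_compl⟩
      rw [interior_compl]
      exact fun hc => hfr ⟨hc, hxi⟩

variable [FiniteDimensional ℝ V]

/-- Local signed functions patch together to a globally smooth signed function of a compact set. -/
theorem exists_contDiff_signed {E K : Set V} (hK : IsCompact K)
    (hloc : ∀ x ∈ K, ∃ U h, x ∈ U ∧ IsSignedIn E U h) :
    ∃ d : V → ℝ, ContDiff ℝ ∞ d ∧ (∀ y ∈ K, 0 < d y ↔ y ∈ interior (closure E)) ∧
      (∀ y ∈ K, d y < 0 ↔ y ∈ interior (closure Eᶜ)) ∧ ∀ y ∈ K, d y = 0 → ‖fderiv ℝ d y‖ = 1 := by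
  choose! U h hxU hs using hloc
  obtain ⟨t, htK, htc⟩ := hK.elim_nhds_subcover U (fun x hx => (hs x hx).isOpen.mem_nhds (hxU x hx))
  have hst : ∀ i : t, IsSignedIn E (U i) (h i) := fun i => hs i (htK i i.2)
  obtain ⟨ρ, hρ⟩ := SmoothPartitionOfUnity.exists_isSubordinate 𝓘(ℝ, V) hK.isClosed
    (fun i : t => U i) (fun i => (hst i).isOpen) (fun y hy => by
      obtain ⟨x, hxt, hyx⟩ := mem_iUnion₂.1 (htc hy)
      exact mem_iUnion.2 ⟨⟨x, hxt⟩, hyx⟩)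
  have hρU : ∀ i, tsupport (ρ i) ⊆ U i := hρ
  have hρd : ∀ i, ContDiff ℝ ∞ (ρ i) := fun i => (ρ i).contMDiff.contDiff
  have hρ0 : ∀ i y, 0 ≤ ρ i y := fun i y => ρ.nonneg i y
  have hρ1 : ∀ y ∈ K, ∑ i, ρ i y = 1 := fun y hy => by
    rw [← finsum_eq_sum_of_fintype]; exact ρ.sum_eq_one hy
  have hmem : ∀ (i : t) y, ρ i y ≠ 0 → y ∈ U i := fun i y hy => hρU i (subset_tsupport _ hy)
  have hzero : ∀ (i : t) y, y ∉ tsupport (ρ i) → (fun z => ρ i z * h i z) =ᶠ[𝓝 y] fun _ => 0 := by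
    intro i y hy
    filter_upwards [(isClosed_tsupport _).isOpen_compl.mem_nhds hy] with z hz
    rw [image_eq_zero_of_notMem_tsupport hz, zero_mul]
  have hhd : ∀ i : t, ∀ y ∈ U i, ContDiffAt ℝ ∞ (h i) y := fun i y hy =>
    (hst i).contDiffOn.contDiffAt ((hst i).isOpen.mem_nhds hy)
  have hterm : ∀ i : t, ContDiff ℝ ∞ fun z => ρ i z * h i z := fun i => contDiff_iff_contDiffAt.2
    fun y => by
      by_cases hy : y ∈ tsupport (ρ i)
      · exact (hρd i).contDiffAt.mul (hhd i y (hρU i hy))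
      · exact contDiffAt_const.congr_of_eventuallyEq (hzero i y hy)
  have hsome : ∀ y ∈ K, ∃ i, 0 < ρ i y := by
    intro y hy
    by_contra! hcon
    have := hρ1 y hy
    rw [Finset.sum_eq_zero fun i _ => le_antisymm (hcon i) (hρ0 i y)] at this
    exact zero_ne_one this
  have hpos : ∀ y ∈ K, y ∈ interior (closure E) → 0 < ∑ i, ρ i y * h i y := by
    intro y hy hyE
    obtain ⟨i, hi⟩ := hsome y hy
    refine Finset.sum_pos' (fun j _ => ?_) ⟨i, Finset.mem_univ i, ?_⟩
    · by_cases hj : ρ j y = 0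
      · rw [hj, zero_mul]
      · exact mul_nonneg (hρ0 j y) (((hst j).pos_iff y (hmem j y hj)).2 hyE).le
    · exact mul_pos hi (((hst i).pos_iff y (hmem i y hi.ne')).2 hyE)
  have hneg : ∀ y ∈ K, y ∈ interior (closure Eᶜ) → ∑ i, ρ i y * h i y < 0 := by
    intro y hy hyE
    obtain ⟨i, hi⟩ := hsome y hy
    refine Finset.sum_neg' (fun j _ => ?_) ⟨i, Finset.mem_univ i, ?_⟩
    · by_cases hj : ρ j y = 0
      · rw [hj, zero_mul]
      · exact mul_nonpos_of_nonneg_of_nonpos (hρ0 j y)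
          (((hst j).neg_iff y (hmem j y hj)).2 hyE).le
    · exact mul_neg_of_pos_of_neg hi (((hst i).neg_iff y (hmem i y hi.ne')).2 hyE)
  have hh0 : ∀ i : t, ∀ y ∈ U i, y ∉ interior (closure E) → y ∉ interior (closure Eᶜ) → h i y = 0 :=
    fun i y hy h1 h2 => le_antisymm (not_lt.1 fun hc => h1 (((hst i).pos_iff y hy).1 hc))
      (not_lt.1 fun hc => h2 (((hst i).neg_iff y hy).1 hc))
  have hnul : ∀ y, y ∉ interior (closure E) → y ∉ interior (closure Eᶜ) →
      ∑ i, ρ i y * h i y = 0 := by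
    intro y h1 h2
    refine Finset.sum_eq_zero fun i _ => ?_
    by_cases hi : ρ i y = 0
    · rw [hi, zero_mul]
    · rw [hh0 i y (hmem i y hi) h1 h2, mul_zero]
  refine ⟨fun y => ∑ i, ρ i y * h i y, ContDiff.sum fun i _ => hterm i, fun y hy => ?_,
    fun y hy => ?_, fun y hy h0 => ?_⟩
  · refine ⟨fun hd => ?_, hpos y hy⟩
    by_contra h1
    by_cases h2 : y ∈ interior (closure Eᶜ)
    · exact lt_asymm hd (hneg y hy h2)
    · exact hd.ne' (hnul y h1 h2)
  · refine ⟨fun hd => ?_, hneg y hy⟩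
    by_contra h1
    by_cases h2 : y ∈ interior (closure E)
    · exact lt_asymm hd (hpos y hy h2)
    · exact hd.ne (hnul y h2 h1)
  · have h1 : y ∉ interior (closure E) := fun hc => (hpos y hy hc).ne' h0
    have h2 : y ∉ interior (closure Eᶜ) := fun hc => (hneg y hy hc).ne h0
    obtain ⟨i₀, hi₀⟩ := hsome y hy
    have hyi₀ := hmem i₀ y hi₀.ne'
    have hN := (hst i₀).norm_fderiv y hyi₀ (hh0 i₀ y hyi₀ h1 h2)
    have hdiff : ∀ i : t, y ∈ U i → HasFDerivAt (h i) (fderiv ℝ (h i) y) y := fun i hi =>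
      ((hhd i y hi).differentiableAt (by simp)).hasFDerivAt
    -- The local functions have the same sign near `y` and unit gradients, so these coincide. In the
    -- gradient of `∑ ρ i * h i` at a zero the terms with derivatives of `ρ i` vanish, leaving a
    -- convex combination of equal unit covectors.
    have hsame : ∀ i : t, y ∈ U i → fderiv ℝ (h i) y = fderiv ℝ (h i₀) y := fun i hi =>
      fderiv_eq_of_same_sign (hdiff i hi) (hdiff i₀ hyi₀) (hh0 i y hi h1 h2)
        (hh0 i₀ y hyi₀ h1 h2) ((hst i).norm_fderiv y hi (hh0 i y hi h1 h2)) hN (by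
          filter_upwards [(hst i).isOpen.mem_nhds hi, (hst i₀).isOpen.mem_nhds hyi₀] with z hz hz₀
          rw [(hst i).pos_iff z hz, (hst i₀).pos_iff z hz₀]
          exact id)
    have hfd : ∀ i : t, HasFDerivAt (fun z => ρ i z * h i z) (ρ i y • fderiv ℝ (h i₀) y) y := by
      intro i
      by_cases hi : y ∈ tsupport (ρ i)
      · have hyi := hρU i hi
        have h3 := (((hρd i).differentiable (by simp)) y).hasFDerivAt.fun_mul (hdiff i hyi)
        rw [hh0 i y hyi h1 h2, zero_smul, add_zero, hsame i hyi] at h3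
        exact h3
      · rw [image_eq_zero_of_notMem_tsupport hi, zero_smul]
        exact (hasFDerivAt_const (0 : ℝ) y).congr_of_eventuallyEq (hzero i y hi)
    have hsum := HasFDerivAt.fun_sum fun i (_ : i ∈ Finset.univ) => hfd i
    rw [hsum.fderiv, ← Finset.sum_smul, hρ1 y hy, one_smul, hN]

end

end

/-! ### Energy of smooth competitors -/

/-- A classical derivative is a weak derivative. -/
theorem hasWeakFDeriv_fderiv {n : ℕ} {F : Type*} [NormedAddCommGroup F] [NormedSpace ℝ F]
    {v : Rn n → F} (hv : ContDiff ℝ 1 v) (A : Set (Rn n)) :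
    HasWeakFDeriv A v (fderiv ℝ v) := by
  intro ζ hζ hζc hζA w
  have hfc : Continuous (fderiv ℝ v) := hv.continuous_fderiv (by norm_num)
  have hζf : Continuous (fderiv ℝ ζ) := hζ.continuous_fderiv (by simp)
  have hζfc : HasCompactSupport fun x => fderiv ℝ ζ x w := hζc.fderiv_apply ℝ w
  rw [setIntegral_eq_integral_of_forall_compl_eq_zero, setIntegral_eq_integral_of_forall_compl_eq_zero]
  · have := integral_smul_fderiv_eq_neg_fderiv_smul_of_integrable (μ := (volume : Measure (Rn n)))
      (𝕜 := ℝ) (f := ζ) (g := v) (v := w) ?_ ?_ ?_ ?_ ?_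
    · rw [this, neg_neg]
    · exact ((hζf.clm_apply continuous_const).smul hv.continuous).integrable_of_hasCompactSupport
        hζfc.smul_right
    · exact (hζ.continuous.smul (hfc.clm_apply continuous_const)).integrable_of_hasCompactSupport
        hζc.smul_right
    · exact (hζ.continuous.smul hv.continuous).integrable_of_hasCompactSupport hζc.smul_right
    · exact fun x _ => (hζ.differentiable (by simp)) x
    · exact fun x _ => (hv.differentiable (by norm_num)) x
  · intro x hx
    rw [image_eq_zero_of_notMem_tsupport fun h => hx (hζA h), zero_smul]
  · intro x hx
    have : x ∉ tsupport (fderiv ℝ ζ) := fun h => hx (hζA (tsupport_fderiv_subset ℝ h))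
    rw [image_eq_zero_of_notMem_tsupport this]
    simp

theorem memLp_of_continuous_of_isBounded {n : ℕ} {F : Type*} [NormedAddCommGroup F]
    {v : Rn n → F} (hv : Continuous v) {A : Set (Rn n)}
    (hbdd : Bornology.IsBounded A) : MemLp v 2 (volume.restrict A) := by
  obtain ⟨C, hC⟩ := (hbdd.isCompact_closure.image hv.norm).isBounded.subset_closedBall 0
  have : IsFiniteMeasure (volume.restrict A) := ⟨by simpa using hbdd.measure_lt_top⟩
  have hb : ∀ x ∈ closure A, ‖v x‖ ≤ C := fun x hx => by
    have := hC ⟨x, hx, rfl⟩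
    simpa using this
  refine MemLp.of_bound hv.aestronglyMeasurable C ?_
  have hae : ∀ᵐ x ∂(volume.restrict (closure A)), ‖v x‖ ≤ C := by
    filter_upwards [ae_restrict_mem isClosed_closure.measurableSet] with x hx using hb x hx
  exact ae_restrict_of_ae_restrict_of_subset subset_closure hae

/-- A `C²` function is in `H²` of every bounded open set. -/
theorem isH2_of_contDiff {n : ℕ} {A : Set (Rn n)} (hbdd : Bornology.IsBounded A)
    {u w : Rn n → ℝ} (hu : ContDiff ℝ 2 u) (hw : w =ᵐ[volume.restrict A] u) :
    IsH2 A w (fderiv ℝ u) (fderiv ℝ (fderiv ℝ u)) := by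
  have hu1 : ContDiff ℝ 1 u := hu.of_le (by norm_num)
  have hDu : ContDiff ℝ 1 (fderiv ℝ u) := hu.fderiv_right (by norm_num)
  refine ⟨(memLp_of_continuous_of_isBounded hu.continuous hbdd).ae_eq hw.symm,
    memLp_of_continuous_of_isBounded hDu.continuous hbdd,
    memLp_of_continuous_of_isBounded (hDu.continuous_fderiv (by norm_num)) hbdd, ?_,
    hasWeakFDeriv_fderiv hDu A⟩
  intro ζ hζ hζc hζA v
  rw [← hasWeakFDeriv_fderiv hu1 A ζ hζ hζc hζA v]
  refine integral_congr_ae ?_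
  filter_upwards [hw] with x hx
  rw [hx]

theorem energy_le_of_contDiff {n : ℕ} {φ : ℝ → ℝ} {A : Set (Rn n)} (hbdd : Bornology.IsBounded A)
    {u : Rn n → ℝ} (hu : ContDiff ℝ 2 u) {w : Lp ℝ 2 (volume.restrict A)}
    (hw : w =ᵐ[volume.restrict A] u) (ν : ℝ) :
    energy φ A ν w ≤ (1 / 2) * ∫⁻ x in A, ENNReal.ofReal
      (ν ^ 3 * ‖fderiv ℝ (fderiv ℝ u) x‖ ^ 2 + 1 / (ν * φ (1 / ν)) * φ ‖fderiv ℝ u x‖) :=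
  iInf_le_of_le _ (iInf_le_of_le _ (iInf_le_of_le (isH2_of_contDiff hbdd hu hw) le_rfl))

theorem contDiff_two_of_infty {V : Type*} [NormedAddCommGroup V] [NormedSpace ℝ V] {f : V → ℝ}
    (hf : ContDiff ℝ ∞ f) : ContDiff ℝ 2 f :=
  contDiff_infty.1 hf 2

section
variable {V : Type*} [NormedAddCommGroup V] [NormedSpace ℝ V] {P : ℝ → ℝ} {η s : ℝ}

theorem SmoothProfile.hasFDerivAt_comp (hP : SmoothProfile η s P) {d : V → ℝ}
    {x : V} (hd : DifferentiableAt ℝ d x) (ν : ℝ) :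
    HasFDerivAt (fun y => P (d y / ν)) ((deriv P (d x / ν) * ν⁻¹) • fderiv ℝ d x) x := by
  have h1 : HasFDerivAt (fun y => d y / ν) (ν⁻¹ • fderiv ℝ d x) x := by
    simpa [div_eq_mul_inv] using hd.hasFDerivAt.mul_const ν⁻¹
  have := (hP.hasDerivAt (d x / ν)).comp_hasFDerivAt x h1
  rwa [smul_smul] at this

/-- The Hessian is a multiple of the Hessian of `d` plus a rank-one term in `fderiv ℝ d x`, whose
operator norm is computed exactly. -/
theorem SmoothProfile.norm_hessian_comp_le (hP : SmoothProfile η s P) {d : V → ℝ}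
    (hd : ContDiff ℝ ∞ d) (x : V) {ν : ℝ} (hν : 0 < ν) :
    ‖fderiv ℝ (fderiv ℝ fun y => P (d y / ν)) x‖ ≤
      |deriv P (d x / ν)| * ν⁻¹ * ‖fderiv ℝ (fderiv ℝ d) x‖ +
        |deriv (deriv P) (d x / ν)| * ν⁻¹ ^ 2 * ‖fderiv ℝ d x‖ ^ 2 := by
  have hdd : ∀ y, DifferentiableAt ℝ d y := fun y => hd.differentiable (by simp) y
  have e1 : fderiv ℝ (fun y => P (d y / ν)) =
      fun y => (deriv P (d y / ν) * ν⁻¹) • fderiv ℝ d y :=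
    funext fun y => (hP.hasFDerivAt_comp (hdd y) ν).fderiv
  have h1 : HasFDerivAt (fun y => d y / ν) (ν⁻¹ • fderiv ℝ d x) x := by
    simpa [div_eq_mul_inv] using (hdd x).hasFDerivAt.mul_const ν⁻¹
  have h2 : HasFDerivAt (fun y => deriv P (d y / ν) * ν⁻¹)
      (ν⁻¹ • (deriv (deriv P) (d x / ν) • (ν⁻¹ • fderiv ℝ d x))) x := by
    have hc := (hP.hasDerivAt_deriv (d x / ν)).comp_hasFDerivAt x h1
    exact hc.mul_const ν⁻¹
  have h3 : HasFDerivAt (fderiv ℝ d) (fderiv ℝ (fderiv ℝ d) x) x :=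
    (((contDiff_two_of_infty hd).fderiv_right (m := 1) (by norm_num)).differentiable
      (by norm_num) x).hasFDerivAt
  have h4 := h2.fun_smul h3
  rw [e1, h4.fderiv]
  refine (norm_add_le (_ : V →L[ℝ] V →L[ℝ] ℝ) _).trans (add_le_add ?_ ?_)
  · refine (ContinuousLinearMap.opNorm_smul_le _ _).trans_eq ?_
    rw [norm_mul, norm_inv, Real.norm_eq_abs, Real.norm_of_nonneg hν.le]
  · rw [ContinuousLinearMap.norm_smulRight_apply, norm_smul, norm_smul, norm_smul, norm_inv,
      Real.norm_of_nonneg hν.le, Real.norm_eq_abs]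
    exact le_of_eq (by ring)

end

/-- The layer profile bounding the energy density of a transition. -/
noncomputable def layerDensity (a η Λ δ : ℝ) (P : ℝ → ℝ) : ℝ → ℝ :=
  (Ioo 0 η).indicator fun r => Λ ^ 4 * profileDensity a P r + δ

/-- The energy density of the transition `P (d / ν)` is bounded by a rescaled layer density. -/
theorem SmoothProfile.eventually_density_le {n : ℕ} {φ : ℝ → ℝ} {a : ℝ} (hφ : IsAdmissible φ a)
    {η s : ℝ} {P : ℝ → ℝ} (hP : SmoothProfile η s P) {d : Rn n → ℝ}
    (hd : ContDiff ℝ ∞ d) {K : Set (Rn n)} (hK : IsCompact K) {Λ : ℝ} (hΛ : 1 ≤ Λ)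
    (hdΛ : ∀ y ∈ K, d y = 0 → ‖fderiv ℝ d y‖ < Λ) {δ : ℝ} (hδ : 0 < δ) :
    ∀ᶠ ν in 𝓝[>] (0 : ℝ), ∀ x ∈ K,
      ν ^ 3 * ‖fderiv ℝ (fderiv ℝ fun y => P (d y / ν)) x‖ ^ 2 +
        1 / (ν * φ (1 / ν)) * φ ‖fderiv ℝ (fun y => P (d y / ν)) x‖ ≤
      ν⁻¹ * layerDensity a η Λ δ P (d x / ν) := by
  have ha := hφ.exponent_mem
  have hDd : Continuous (fderiv ℝ d) := hd.continuous_fderiv (by simp)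
  have hDDd : Continuous (fderiv ℝ (fderiv ℝ d)) :=
    ((contDiff_two_of_infty hd).fderiv_right (m := 1) (by norm_num)).continuous_fderiv (by norm_num)
  obtain ⟨M₁, hM₁⟩ := (isCompact_Icc (a := (0 : ℝ)) (b := η)).exists_bound_of_continuousOn
    hP.contDiff_deriv.continuous.continuousOn
  obtain ⟨M₂, hM₂⟩ := (isCompact_Icc (a := (0 : ℝ)) (b := η)).exists_bound_of_continuousOn
    hP.continuous_deriv2.continuousOn
  obtain ⟨C, hC⟩ := hK.exists_bound_of_continuousOn
    (f := fderiv ℝ (fderiv ℝ d)) hDDd.continuousOn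
  set M := max (max M₁ M₂) (max C 0) with hM
  have hM0 : 0 ≤ M := (le_max_right C 0).trans (le_max_right _ _)
  -- Points with gradient at least `Λ` have `|d| > c`, so for `ν η < c` the layer avoids them: the
  -- gradient bound at the zeros extends to the whole layer.
  obtain ⟨c, hc, hlt⟩ := exists_pos_forall_lt_abs
    (hK.inter_right (isClosed_le continuous_const hDd.norm :
      IsClosed {y | Λ ≤ ‖fderiv ℝ d y‖})) hd.continuous
    (fun y hy h0 => absurd (hdΛ y hy.1 h0) (not_lt.2 hy.2))
  have hlim : ∀ B b : ℝ, 0 < b → ∀ᶠ ν in 𝓝[>] (0 : ℝ), ν * B < b := by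
    intro B b hb
    have : Tendsto (fun t : ℝ => t * B) (𝓝[>] 0) (𝓝 (0 * B)) :=
      (tendsto_nhdsWithin_of_tendsto_nhds tendsto_id).mul_const _
    rw [zero_mul] at this
    exact this.eventually_lt_const hb
  -- The constant `2 Λ² M³ + M⁴` collects the cross term and the curvature term of the squared
  -- Hessian, both of lower order in `ν`; `ν < 1` absorbs one power of `ν`.
  filter_upwards [hlim η c hc, hlim 1 1 one_pos, hlim (2 * Λ ^ 2 * M ^ 3 + M ^ 4) (δ / 2)
    (by positivity), hφ.eventually_div_le (Λ * M) (half_pos hδ), self_mem_nhdsWithin]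
    with ν hν1 hν2 hν3 hν4 hν0 x hx
  have hν0 : 0 < ν := hν0
  rw [(hP.hasFDerivAt_comp (hd.differentiable (by simp) x) ν).fderiv]
  have hH := hP.norm_hessian_comp_le hd x hν0
  set r := d x / ν with hr
  by_cases hrI : r ∈ Ioo 0 η
  · rw [layerDensity, indicator_of_mem hrI, profileDensity]
    have hp : |deriv P r| ≤ M := (hM₁ r (Ioo_subset_Icc_self hrI)).trans
      ((le_max_left _ _).trans (le_max_left _ _))
    have hg : |deriv (deriv P) r| ≤ M := (hM₂ r (Ioo_subset_Icc_self hrI)).trans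
      ((le_max_right _ _).trans (le_max_left _ _))
    have hC' : ‖fderiv ℝ (fderiv ℝ d) x‖ ≤ M := (hC x hx).trans
      ((le_max_left _ _).trans (le_max_right _ _))
    have hdx : ‖fderiv ℝ d x‖ ≤ Λ := by
      by_contra hcon
      have h1 := hlt x ⟨hx, (not_le.1 hcon).le⟩
      have h2 : d x = r * ν := by rw [hr]; field_simp
      rw [h2, abs_of_pos (mul_pos hrI.1 hν0)] at h1
      nlinarith [hrI.2]
    set p := |deriv P r| with hpdef
    set g := |deriv (deriv P) r| with hgdef
    have hp0 : 0 ≤ p := abs_nonneg _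
    have hg0 : 0 ≤ g := abs_nonneg _
    have hg2 : deriv (deriv P) r ^ 2 = g ^ 2 := (sq_abs _).symm
    have hfirst : ν ^ 3 * ‖fderiv ℝ (fderiv ℝ fun y => P (d y / ν)) x‖ ^ 2 ≤
        ν⁻¹ * (Λ ^ 4 * g ^ 2 + δ / 2) := by
      have h1 : ‖fderiv ℝ (fderiv ℝ fun y => P (d y / ν)) x‖ ≤
          ν⁻¹ ^ 2 * (ν * (p * M) + g * Λ ^ 2) := by
        refine hH.trans ?_
        calc _ ≤ p * ν⁻¹ * M + g * ν⁻¹ ^ 2 * Λ ^ 2 := by gcongr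
          _ = _ := by field_simp
      calc _ ≤ ν ^ 3 * (ν⁻¹ ^ 2 * (ν * (p * M) + g * Λ ^ 2)) ^ 2 := by gcongr
        _ = ν⁻¹ * (Λ ^ 4 * g ^ 2 + ν * (2 * Λ ^ 2 * (g * p * M)) + ν ^ 2 * (p * M) ^ 2) := by
            field_simp; ring
        _ ≤ ν⁻¹ * (Λ ^ 4 * g ^ 2 + ν * (2 * Λ ^ 2 * M ^ 3) + ν * M ^ 4) := by
            have h2 : g * p * M ≤ M ^ 3 := by
              calc g * p * M ≤ M * M * M := by gcongr
                _ = M ^ 3 := by ring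
            have h3 : ν ^ 2 * (p * M) ^ 2 ≤ ν * M ^ 4 := by
              calc ν ^ 2 * (p * M) ^ 2 ≤ ν ^ 2 * (M * M) ^ 2 := by gcongr
                _ = ν * (ν * M ^ 4) := by ring
                _ ≤ ν * (1 * M ^ 4) := by gcongr; linarith
                _ = ν * M ^ 4 := by ring
            gcongr
        _ ≤ _ := by
            refine mul_le_mul_of_nonneg_left ?_ (inv_nonneg.2 hν0.le)
            linarith
    have hsecond : 1 / (ν * φ (1 / ν)) * φ ‖(deriv P r * ν⁻¹) • fderiv ℝ d x‖ ≤
        ν⁻¹ * (Λ ^ 4 * p ^ a + δ / 2) := by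
      have h1 : ‖(deriv P r * ν⁻¹) • fderiv ℝ d x‖ ≤ Λ * p / ν := by
        rw [norm_smul, norm_mul, norm_inv, Real.norm_of_nonneg hν0.le, Real.norm_eq_abs]
        calc p * ν⁻¹ * ‖fderiv ℝ d x‖ ≤ p * ν⁻¹ * Λ := by gcongr
          _ = Λ * p / ν := by ring
      have h2 : φ ‖(deriv P r * ν⁻¹) • fderiv ℝ d x‖ ≤ φ (Λ * p / ν) :=
        hφ.monotoneOn (norm_nonneg _) ((norm_nonneg _).trans h1) h1
      have h3 := hν4 (Λ * p) ⟨by positivity, by gcongr⟩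
      have h4 : (Λ * p) ^ a ≤ Λ ^ 4 * p ^ a := by
        rw [Real.mul_rpow (by linarith) hp0]
        gcongr
        calc Λ ^ a ≤ Λ ^ (4 : ℝ) := Real.rpow_le_rpow_of_exponent_le hΛ (by linarith [ha.2])
          _ = Λ ^ 4 := by norm_cast
      calc _ ≤ 1 / (ν * φ (1 / ν)) * φ (Λ * p / ν) := by
            have := hφ.nonneg (1 / ν)
            gcongr
        _ = ν⁻¹ * (φ (Λ * p / ν) / φ (1 / ν)) := by
            rw [one_div, mul_inv, div_eq_mul_inv]; ring
        _ ≤ ν⁻¹ * ((Λ * p) ^ a + δ / 2) := by gcongr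
        _ ≤ _ := by gcongr
    calc _ ≤ ν⁻¹ * (Λ ^ 4 * g ^ 2 + δ / 2) + ν⁻¹ * (Λ ^ 4 * p ^ a + δ / 2) :=
          add_le_add hfirst hsecond
      _ = _ := by rw [hg2]; ring
  -- Off the layer both derivatives of the competitor vanish and `φ 0 = 0`. The cutoff in
  -- `layerDensity` matters when `a = 0`, as `profileDensity` equals `1` where the profile is
  -- constant.
  · have hr' : r ≤ 0 ∨ η ≤ r := by
      by_contra hcon
      rw [not_or, not_le, not_le] at hcon
      exact hrI hcon
    rw [hP.deriv_eq_zero hr', hP.deriv2_eq_zero hr'] at *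
    simp only [abs_zero, zero_mul, add_zero] at hH
    rw [le_antisymm hH (ContinuousLinearMap.opNorm_nonneg _), layerDensity, indicator_of_notMem hrI]
    simp [(hφ.eq_zero_iff 0).2 rfl]

theorem measurable_layerDensity {η s : ℝ} {P : ℝ → ℝ} (hP : SmoothProfile η s P) {a : ℝ}
    (ha : 0 ≤ a) (Λ δ : ℝ) : Measurable fun r => ENNReal.ofReal (layerDensity a η Λ δ P r) :=
  (((hP.continuous_density ha).measurable.const_mul _ |>.add_const δ).indicator
    measurableSet_Ioo).ennreal_ofReal

theorem lintegral_layerDensity {η s : ℝ} {P : ℝ → ℝ} (hP : SmoothProfile η s P) {a : ℝ}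
    (ha : 0 ≤ a) (hη : 0 < η) {Λ δ : ℝ} (hΛ : 1 ≤ Λ) (hδ : 0 ≤ δ) :
    ∫⁻ r, ENNReal.ofReal (layerDensity a η Λ δ P r) =
      ENNReal.ofReal (Λ ^ 4 * (∫ t in (0 : ℝ)..η, profileDensity a P t) + δ * η) := by
  have e : ∀ r, ENNReal.ofReal (layerDensity a η Λ δ P r) =
      (Ioo 0 η).indicator (fun r => ENNReal.ofReal (Λ ^ 4 * profileDensity a P r + δ)) r := by
    intro r
    by_cases hr : r ∈ Ioo 0 η <;> simp [layerDensity, hr]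
  have hc : Continuous fun r => Λ ^ 4 * profileDensity a P r + δ :=
    ((hP.continuous_density ha).const_mul _).add continuous_const
  have hnn : ∀ r, 0 ≤ Λ ^ 4 * profileDensity a P r + δ := fun r =>
    add_nonneg (mul_nonneg (by positivity) (profileDensity_nonneg a P r)) hδ
  simp_rw [e]
  rw [lintegral_indicator measurableSet_Ioo, ← ofReal_integral_eq_lintegral_ofReal
    ((hc.integrableOn_Icc).mono_set Ioo_subset_Icc_self) (ae_of_all _ hnn),
    ← integral_Ioc_eq_integral_Ioo, ← intervalIntegral.integral_of_le hη.le,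
    intervalIntegral.integral_add, intervalIntegral.integral_const_mul,
    intervalIntegral.integral_const]
  · congr 1
    rw [sub_zero, smul_eq_mul]; ring
  · exact ((hP.continuous_density ha).const_mul _).intervalIntegrable _ _
  · exact continuous_const.intervalIntegrable _ _

/-- The energy of the transition `P (d / ν)` across the regular level set `{d = 0}`. -/
theorem SmoothProfile.eventually_energy_le {m : ℕ} {φ : ℝ → ℝ} {a : ℝ} (hφ : IsAdmissible φ a)
    {η s : ℝ} {P : ℝ → ℝ} (hP : SmoothProfile η s P) (hη : 0 < η) {d : Rn (m + 1) → ℝ}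
    (hd : ContDiff ℝ ∞ d) {A : Set (Rn (m + 1))} (hA : Bornology.IsBounded A) {Λ : ℝ} (hΛ : 1 ≤ Λ)
    (hdΛ : ∀ y ∈ closure A, d y = 0 → ‖fderiv ℝ d y‖ < Λ)
    (hdΛ' : ∀ y ∈ closure A, d y = 0 → Λ⁻¹ < ‖fderiv ℝ d y‖) {δ : ℝ} (hδ : 0 < δ)
    {ε : ℝ≥0∞} (hε : ε ≠ 0) :
    ∀ᶠ ν in 𝓝[>] (0 : ℝ), ∀ w : Lp ℝ 2 (volume.restrict A),
      (w =ᵐ[volume.restrict A] fun x => P (d x / ν)) → energy φ A ν w ≤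
        ENNReal.ofReal (1 / 2 * Λ * (Λ ^ 4 * (∫ t in (0 : ℝ)..η, profileDensity a P t) + δ * η)) *
          (μHE[m] (closure A ∩ {y | d y = 0}) + ε) := by
  have hK : IsCompact (closure A) := hA.isCompact_closure
  have hΛ0 : 0 < Λ := by linarith
  have ha := hφ.exponent_mem.1
  have hlayer := layerBound_of_isCompact (f := d) (hd.of_le (by exact_mod_cast le_top)) hK hΛ0 hdΛ'
    (measurable_layerDensity hP ha Λ δ) (η := η) (fun r hr => by
      rw [layerDensity, indicator_of_notMem hr, ENNReal.ofReal_zero])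
  rw [lintegral_layerDensity hP ha hη hΛ hδ.le] at hlayer
  filter_upwards [hP.eventually_density_le hφ hd hK hΛ hdΛ hδ, hlayer ε hε,
    self_mem_nhdsWithin] with ν h1 h2 hν0 w hw
  have hν0 : 0 < ν := hν0
  have hC2 : ContDiff ℝ 2 fun x => P (d x / ν) :=
    hP.contDiff.comp ((contDiff_two_of_infty hd).div_const ν)
  refine (energy_le_of_contDiff hA hC2 hw ν).trans ?_
  have h3 : ∫⁻ x in A, ENNReal.ofReal
      (ν ^ 3 * ‖fderiv ℝ (fderiv ℝ fun y => P (d y / ν)) x‖ ^ 2 +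
        1 / (ν * φ (1 / ν)) * φ ‖fderiv ℝ (fun y => P (d y / ν)) x‖) ≤
      ENNReal.ofReal ν⁻¹ * ∫⁻ x in closure A, ENNReal.ofReal (layerDensity a η Λ δ P (d x / ν)) := by
    rw [← lintegral_const_mul' _ _ ENNReal.ofReal_ne_top]
    refine (lintegral_mono_set subset_closure).trans ?_
    refine setLIntegral_mono' hK.measurableSet fun x hx => ?_
    rw [← ENNReal.ofReal_mul (by positivity)]
    exact ENNReal.ofReal_le_ofReal (h1 x hx)
  have hhalf : (1 / 2 : ℝ≥0∞) = ENNReal.ofReal (1 / 2) := by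
    rw [ENNReal.ofReal_div_of_pos (by norm_num)]; simp
  calc _ ≤ (1 / 2) * _ := mul_le_mul_right (h3.trans h2) _
    _ = _ := by
      rw [hhalf, mul_assoc (1 / 2 : ℝ), ENNReal.ofReal_mul (by norm_num : (0 : ℝ) ≤ 1 / 2),
        ENNReal.ofReal_mul hΛ0.le]
      ring

/-! ### Area, gradients and convergence for displaced interfaces -/

/-- A smooth hypersurface is locally null and has locally finite area. -/
theorem IsSmoothHypersurfaceIn.measure_inter {m : ℕ} {U M K : Set (Rn (m + 1))}
    (h : IsSmoothHypersurfaceIn U M) (hM : IsClosed M) (hK : IsCompact K) (hKU : K ⊆ U) :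
    volume (M ∩ K) = 0 ∧ μHE[m] (M ∩ K) < ⊤ := by
  have hloc : ∀ x ∈ M ∩ K, ∃ t ∈ 𝓝[M ∩ K] x, volume t = 0 ∧ μHE[m] t < ⊤ := by
    intro x hx
    obtain ⟨W, f, hW, hxW, hf, hd, hzero⟩ := h x ⟨hx.1, hKU hx.2⟩
    obtain ⟨s, hs, h1, h2⟩ := exists_nhds_levelSet_null
      ((hf.contDiffAt (hW.mem_nhds hxW)).hasStrictFDerivAt (by simp)) (hd x hxW)
    refine ⟨s ∩ {y | f y = 0}, ?_, h1, h2⟩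
    refine inter_mem (nhdsWithin_le_nhds hs) ?_
    filter_upwards [self_mem_nhdsWithin, nhdsWithin_le_nhds (hW.mem_nhds hxW)] with y hy hyW
    have : y ∈ {y ∈ W | f y = 0} := hzero ▸ ⟨hy.1, hyW⟩
    exact this.2
  refine ⟨measure_null_of_locally_null _ fun x hx => ?_,
    (hK.inter_left hM).measure_lt_top_of_nhdsWithin fun x hx => ?_⟩
  · obtain ⟨t, ht, h0, -⟩ := hloc x hx
    exact ⟨t, ht, h0⟩
  · obtain ⟨t, ht, -, h1⟩ := hloc x hx
    exact ⟨t, ht, h1⟩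

section
variable {V : Type*} [NormedAddCommGroup V] [NormedSpace ℝ V] {X : V → V} {C : ℝ≥0} {ε : ℝ}

/-- The triangle inequality gives the factor `1 - ε C`, and `(1 + 2x)(1 - x) ≥ 1` for `0 ≤ x ≤ 1 /
2`. -/
theorem dist_le_of_perturbation (hX : LipschitzWith C X) (hε : 0 ≤ ε) (hC : ε * C ≤ 1 / 2)
    (x y : V) : dist x y ≤ (1 + 2 * (ε * C)) * dist (x + ε • X x) (y + ε • X y) := by
  have h1 : dist x y ≤ dist (x + ε • X x) (y + ε • X y) + ε * C * dist x y := by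
    have h2 := hX.dist_le_mul x y
    have e : x - y = ((x + ε • X x) - (y + ε • X y)) - ε • (X x - X y) := by
      rw [smul_sub]; abel
    calc dist x y = ‖x - y‖ := dist_eq_norm _ _
      _ ≤ ‖(x + ε • X x) - (y + ε • X y)‖ + ‖ε • (X x - X y)‖ := by
          conv_lhs => rw [e]
          exact norm_sub_le _ _
      _ ≤ _ := by
          rw [← dist_eq_norm, norm_smul, Real.norm_of_nonneg hε, ← dist_eq_norm, mul_assoc]
          gcongr
  have h0 : 0 ≤ ε * C := by positivity
  have h3 : (1 - ε * C) * dist x y ≤ dist (x + ε • X x) (y + ε • X y) := by linarith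
  have h4 : 1 ≤ (1 + 2 * (ε * C)) * (1 - ε * C) := by nlinarith
  calc dist x y = 1 * dist x y := (one_mul _).symm
    _ ≤ (1 + 2 * (ε * C)) * (1 - ε * C) * dist x y := by gcongr
    _ = (1 + 2 * (ε * C)) * ((1 - ε * C) * dist x y) := by ring
    _ ≤ _ := by gcongr

/-- By the chain rule the differential is `L + ε L ∘ DX` with `‖L‖ = 1` and `‖DX‖ ≤ C`. -/
theorem norm_fderiv_comp_perturbation (hX : LipschitzWith C X) (hXd : Differentiable ℝ X)
    {d : V → ℝ} (hd : Differentiable ℝ d) (hε : 0 ≤ ε) {x : V}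
    (h1 : ‖fderiv ℝ d (x + ε • X x)‖ = 1) :
    ‖fderiv ℝ (fun y => d (y + ε • X y)) x‖ ≤ 1 + ε * C ∧
      1 - ε * C ≤ ‖fderiv ℝ (fun y => d (y + ε • X y)) x‖ := by
  set L := fderiv ℝ d (x + ε • X x) with hL
  have hΦ : HasFDerivAt (fun y => y + ε • X y) (ContinuousLinearMap.id ℝ V + ε • fderiv ℝ X x) x :=
    (hasFDerivAt_id x).add ((hXd x).hasFDerivAt.const_smul ε)
  have hcomp : HasFDerivAt (fun y => d (y + ε • X y))
      (L.comp (ContinuousLinearMap.id ℝ V + ε • fderiv ℝ X x)) x :=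
    ((hd (x + ε • X x)).hasFDerivAt).comp x hΦ
  have e : L.comp (ContinuousLinearMap.id ℝ V + ε • fderiv ℝ X x) =
      L + ε • L.comp (fderiv ℝ X x) := by
    ext v; simp
  have hb : ‖ε • L.comp (fderiv ℝ X x)‖ ≤ ε * C := by
    rw [norm_smul, Real.norm_of_nonneg hε]
    refine mul_le_mul_of_nonneg_left ?_ hε
    refine (L.opNorm_comp_le _).trans ?_
    rw [h1, one_mul]
    exact norm_fderiv_le_of_lipschitz ℝ hX
  rw [hcomp.fderiv, e]
  constructor
  · refine (norm_add_le _ _).trans ?_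
    rw [h1]; linarith
  · have := norm_sub_le (L + ε • L.comp (fderiv ℝ X x)) (ε • L.comp (fderiv ℝ X x))
    rw [add_sub_cancel_right, h1] at this
    linarith

end

/-- Transitions across a perturbed interface are `L²`-close to the limit, if they agree with it
outside of a thin neighbourhood of the interface. -/
theorem exists_thin_neighbourhood {n : ℕ} {A K : Set (Rn n)} (hAK : A ⊆ K) (hA : IsOpen A)
    (hK : IsCompact K) {d : Rn n → ℝ} (hd : Continuous d) (h0 : volume (K ∩ {y | d y = 0}) = 0)
    (c : ℝ) {δ : ℝ} (hδ : 0 < δ) :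
    ∃ r > 0, ∀ u w : Lp ℝ 2 (volume.restrict A),
      (∀ᵐ x ∂volume.restrict A, |w x - u x| ≤ c ∧ (r < |d x| → w x = u x)) → dist w u < δ := by
  set S : ℝ → Set (Rn n) := fun r => K ∩ {y | |d y| ≤ r} with hS
  have hSm : ∀ r, MeasurableSet (S r) := fun r =>
    hK.measurableSet.inter (isClosed_le hd.abs continuous_const).measurableSet
  have htend : Tendsto (volume ∘ S) (𝓝[>] 0) (𝓝 0) := by
    -- Continuity from above: the neighbourhoods `{|d| ≤ r}` in `K` shrink to the null set `{d =
    -- 0}`. The `L²` distance is then at most `|c|` times the square root of their volume.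
    have := tendsto_measure_biInter_gt (μ := volume) (s := S) (a := (0 : ℝ))
      (fun r _ => (hSm r).nullMeasurableSet)
      (fun i j _ hij => inter_subset_inter_right _ fun y (hy : |d y| ≤ i) => hy.trans hij)
      ⟨1, one_pos, ((measure_mono inter_subset_left).trans_lt hK.measure_lt_top).ne⟩
    have h1 : volume (⋂ r, ⋂ (_ : r > 0), S r) = 0 := by
      refine measure_mono_null (fun y hy => ?_) h0
      rw [mem_iInter₂] at hy
      refine ⟨(hy 1 one_pos).1, ?_⟩
      have : |d y| ≤ 0 := le_of_forall_pos_le_add fun ε hε => by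
        rw [zero_add]; exact (hy ε hε).2
      exact abs_eq_zero.1 (le_antisymm this (abs_nonneg _))
    rwa [h1] at this
  have htend2 : Tendsto (fun r => ‖c‖ₑ * volume (S r) ^ (1 / 2 : ℝ)) (𝓝[>] 0) (𝓝 0) := by
    have h2 := ((ENNReal.continuous_rpow_const (y := (1 / 2 : ℝ))).tendsto 0).comp htend
    rw [ENNReal.zero_rpow_of_pos (by norm_num)] at h2
    have h3 := ENNReal.Tendsto.const_mul (a := ‖c‖ₑ) h2 (Or.inr enorm_ne_top)
    rwa [mul_zero] at h3
  have hδ' : (0 : ℝ≥0∞) < ENNReal.ofReal δ := ENNReal.ofReal_pos.2 hδ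
  obtain ⟨r, hr, hr0⟩ := ((htend2.eventually_lt_const hδ').and self_mem_nhdsWithin).exists
  refine ⟨r, hr0, fun u w hw => ?_⟩
  rw [← ENNReal.ofReal_lt_ofReal_iff hδ, ← edist_dist, Lp.edist_def]
  refine lt_of_le_of_lt ?_ hr
  have hmono : eLpNorm (⇑w - ⇑u) 2 (volume.restrict A) ≤
      eLpNorm ((S r).indicator fun _ => c) 2 (volume.restrict A) := by
    refine eLpNorm_mono_ae ?_
    filter_upwards [hw, ae_restrict_mem hA.measurableSet] with x hx hxA
    rw [Pi.sub_apply, Real.norm_eq_abs, Real.norm_eq_abs]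
    by_cases hxr : |d x| ≤ r
    · rw [indicator_of_mem (show x ∈ S r from ⟨hAK hxA, hxr⟩)]
      exact hx.1.trans (le_abs_self c)
    · rw [hx.2 (not_le.1 hxr), sub_self, abs_zero]
      exact abs_nonneg _
  refine hmono.trans ?_
  rw [eLpNorm_indicator_const (hSm r) (by norm_num) (by norm_num)]
  have : (2 : ℝ≥0∞).toReal = 2 := by norm_num
  rw [this]
  gcongr
  exact Measure.restrict_le_self

theorem SmoothProfile.exists_bound {η s : ℝ} {P : ℝ → ℝ} (hP : SmoothProfile η s P) :
    ∃ c, ∀ t, |P t| ≤ c := by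
  obtain ⟨c, hc⟩ := (isCompact_Icc (a := (0 : ℝ)) (b := η)).exists_bound_of_continuousOn
    hP.contDiff.continuous.continuousOn
  refine ⟨max c |s|, fun t => ?_⟩
  by_cases h0 : t ≤ 0
  · rw [hP.left t h0, abs_zero]
    exact (abs_nonneg s).trans (le_max_right _ _)
  · by_cases h1 : η ≤ t
    · rw [hP.right t h1]; exact le_max_right _ _
    · exact (hc t ⟨(not_le.1 h0).le, (not_le.1 h1).le⟩).trans (le_max_left _ _)

/-! ### Assembly of the competitors -/

/-- The upper bound for the `Γ-limsup`, when `A` lies in a set `B` with Lipschitz boundary. -/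
theorem gammaLimsup_energy_le {m : ℕ} {φ : ℝ → ℝ} {a : ℝ} (hφ : IsAdmissible φ a)
    {Ω Ω' E B A : Set (Rn (m + 1))} (hΩ' : Bornology.IsBounded Ω') (hΩΩ' : closure Ω ⊆ Ω')
    (hE : IsSmoothHypersurfaceIn Ω' (frontier E)) (hB : IsOpenLipschitz B) (hBΩ : B ⊆ Ω)
    (hA : IsOpen A) (hAB : A ⊆ B) (s : ℝ) (u : Lp ℝ 2 (volume.restrict A))
    (hu : u =ᵐ[volume.restrict A] (E ∩ Ω).indicator fun _ => s) :
    gammaLimsup (energy φ A) u ≤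
      sigma a * ENNReal.ofReal (|s| ^ ((2 + a) / (4 - a))) *
        μHE[m] (closure A ∩ (frontier E ∩ B)) := by
  set J := sigma a * ENNReal.ofReal (|s| ^ ((2 + a) / (4 - a))) with hJ
  set K := closure Ω with hKdef
  have hΩb : Bornology.IsBounded Ω := hΩ'.subset (subset_closure.trans hΩΩ')
  have hK : IsCompact K := hΩb.isCompact_closure
  have hBb : Bornology.IsBounded B := hΩb.subset hBΩ
  have hAb : Bornology.IsBounded A := hBb.subset hAB
  have hBK : B ⊆ K := hBΩ.trans subset_closure
  have hclAK : closure A ⊆ K := closure_mono (hAB.trans hBΩ)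
  have hAK : A ⊆ K := subset_closure.trans hclAK
  obtain ⟨hnull, hfin⟩ := hE.measure_inter isClosed_frontier hK hΩΩ'
  set H := μHE[m] (closure A ∩ (frontier E ∩ B)) with hH
  have hsub : closure A ∩ (frontier E ∩ B) ⊆ frontier E ∩ K := fun x hx => ⟨hx.2.1, hBK hx.2.2⟩
  have hHtop : H ≠ ⊤ := ((measure_mono hsub).trans_lt hfin).ne
  have hJtop : J ≠ ⊤ := ENNReal.mul_ne_top (sigma_ne_top hφ.exponent_mem) ENNReal.ofReal_ne_top
  -- Every `L'` strictly above the claimed bound will do. The gap absorbs the excess of the profile,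
  -- the distortion by the displacement and the errors of the layer estimate.
  refine le_of_forall_gt_imp_ge_of_dense fun L' hL' => ?_
  -- the transition profile
  obtain ⟨J', hJ'1, hJ'2⟩ : ∃ J', J' * H < L' ∧ J < J' := by
    have h1 : Tendsto (fun x : ℝ≥0∞ => x * H) (𝓝[>] J) (𝓝 (J * H)) :=
      ENNReal.Tendsto.mul_const (tendsto_nhdsWithin_of_tendsto_nhds tendsto_id) (Or.inr hHtop)
    have : (𝓝[>] J).NeBot := nhdsGT_neBot_of_exists_gt ⟨⊤, hJtop.lt_top⟩
    exact ((h1.eventually_lt_const hL').and self_mem_nhdsWithin).exists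
  obtain ⟨η, hη, P, hP, hPJ⟩ := exists_smoothProfile_lt hφ.exponent_mem s hJ'2
  set I := ∫ t in (0 : ℝ)..η, profileDensity a P t with hI
  have hI0 : 0 ≤ I := intervalIntegral.integral_nonneg hη.le fun t _ => profileDensity_nonneg a P t
  obtain ⟨cP, hcP⟩ := hP.exists_bound
  -- the defining function of the interface
  obtain ⟨d, hd, hdpos, hdneg, hd1⟩ := exists_contDiff_signed (E := E) hK fun x hx =>
    exists_isSignedIn fun hxE => hE x ⟨hxE, hΩΩ' hx⟩
  have hdzero : ∀ y ∈ K, d y = 0 → y ∈ frontier E := by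
    intro y hy h0
    refine ⟨?_, fun hc => h0.not_gt ((hdpos y hy).2 (interior_mono subset_closure hc))⟩
    by_contra hc
    have : y ∈ interior Eᶜ := by rwa [interior_compl]
    exact h0.not_lt ((hdneg y hy).2 (interior_mono subset_closure this))
  have hdnull : volume (K ∩ {y | d y = 0}) = 0 :=
    measure_mono_null (fun y hy => (⟨hdzero y hy.1 hy.2, hy.1⟩ : y ∈ frontier E ∩ K)) hnull
  -- the inward field
  obtain ⟨X, hXs, hXc, hXB⟩ := hB.exists_inward_field hBb
  have hXd : Differentiable ℝ X := hXs.differentiable (by simp)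
  obtain ⟨C₁, hC₁⟩ := ContDiff.lipschitzWith_of_hasCompactSupport hXc hXs (by simp)
  obtain ⟨C₂, hC₂⟩ := hXc.exists_bound_of_continuous hXs.continuous
  obtain ⟨R, hR⟩ := hK.isBounded.subset_closedBall 0
  obtain ⟨D, hD⟩ := (isCompact_closedBall (0 : Rn (m + 1)) R).exists_bound_of_continuousOn
    (hd.continuous_fderiv (by simp)).continuousOn
  set C : ℝ≥0 := max C₁ (Real.toNNReal C₂) + 1 with hC
  have hC0 : (0 : ℝ) < C := by rw [hC]; positivity
  have hXL : LipschitzWith C X := hC₁.weaken ((le_max_left _ _).trans le_self_add)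
  have hXC : ∀ x, ‖X x‖ ≤ C := fun x => (hC₂ x).trans <| by
    refine (Real.le_coe_toNNReal C₂).trans ?_
    exact_mod_cast (le_max_right _ _).trans le_self_add
  refine gammaLimsup_le_of_forall_eventually fun δ hδ => ?_
  obtain ⟨r, hr, hthin⟩ := exists_thin_neighbourhood hAK hA hK hd.continuous hdnull (cP + |s|) hδ
  -- the choice of the perturbation parameter
  have hlim : ∀ b c : ℝ, 0 < c → ∀ᶠ ε in 𝓝[>] (0 : ℝ), ε * b < c := by
    intro b c hc
    have : Tendsto (fun t : ℝ => t * b) (𝓝[>] 0) (𝓝 (0 * b)) :=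
      (tendsto_nhdsWithin_of_tendsto_nhds tendsto_id).mul_const _
    rw [zero_mul] at this
    exact this.eventually_lt_const hc
  -- As `ε → 0` the left side tends to `ofReal (1 / 2 * I) * H`, at most `J' * H < L'`. The closed
  -- thickenings of `A` decrease to `closure A`, and their measures converge because the interface
  -- has finite area in `B`.
  have hbound : ∀ᶠ ε in 𝓝[>] (0 : ℝ),
      ENNReal.ofReal (1 / 2 * (1 + 2 * (ε * C)) * ((1 + 2 * (ε * C)) ^ 4 * I + ε * η)) *
        (ENNReal.ofReal (1 + 2 * (ε * C)) ^ m *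
          (μHE[m].restrict (frontier E ∩ B)) (Metric.cthickening (ε * C) A) +
            ENNReal.ofReal ε) < L' := by
    have hΛ : Tendsto (fun ε : ℝ => 1 + 2 * (ε * C)) (𝓝[>] 0) (𝓝 1) := by
      have : Tendsto (fun ε : ℝ => 1 + 2 * (ε * C)) (𝓝 0) (𝓝 (1 + 2 * (0 * C))) :=
        (by fun_prop : Continuous fun ε : ℝ => 1 + 2 * (ε * C)).tendsto 0
      rw [zero_mul, mul_zero, add_zero] at this
      exact tendsto_nhdsWithin_of_tendsto_nhds this
    have h1 : Tendsto (fun ε : ℝ => ENNReal.ofReal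
        (1 / 2 * (1 + 2 * (ε * C)) * ((1 + 2 * (ε * C)) ^ 4 * I + ε * η))) (𝓝[>] 0)
        (𝓝 (ENNReal.ofReal (1 / 2 * I))) := by
      refine (ENNReal.continuous_ofReal.tendsto _).comp (tendsto_nhdsWithin_of_tendsto_nhds ?_)
      have := (by fun_prop : Continuous fun ε : ℝ =>
        1 / 2 * (1 + 2 * (ε * C)) * ((1 + 2 * (ε * C)) ^ 4 * I + ε * η)).tendsto 0
      simpa using this
    have h2 : Tendsto (fun ε : ℝ => (μHE[m].restrict (frontier E ∩ B))
        (Metric.cthickening (ε * C) A)) (𝓝[>] 0) (𝓝 H) := by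
      have hf : IsFiniteMeasure (μHE[m].restrict (frontier E ∩ B)) := ⟨by
        rw [Measure.restrict_apply_univ]
        exact (measure_mono (inter_subset_inter_right _ hBK)).trans_lt hfin⟩
      have h3 := tendsto_measure_cthickening (μ := μHE[m].restrict (frontier E ∩ B)) (s := A)
        ⟨1, one_pos, measure_ne_top _ _⟩
      rw [Measure.restrict_apply isClosed_closure.measurableSet] at h3
      refine h3.comp (tendsto_nhdsWithin_of_tendsto_nhds ?_)
      have := (by fun_prop : Continuous fun ε : ℝ => ε * (C : ℝ)).tendsto 0
      rwa [zero_mul] at this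
    have h4 : Tendsto (fun ε : ℝ => ENNReal.ofReal (1 + 2 * (ε * C)) ^ m) (𝓝[>] 0) (𝓝 1) := by
      have := ENNReal.Tendsto.pow (n := m) ((ENNReal.continuous_ofReal.tendsto 1).comp hΛ)
      simpa using this
    have h5 : Tendsto (fun ε : ℝ => ENNReal.ofReal ε) (𝓝[>] 0) (𝓝 0) := by
      have := (ENNReal.continuous_ofReal.tendsto 0)
      rw [ENNReal.ofReal_zero] at this
      exact tendsto_nhdsWithin_of_tendsto_nhds this
    have h6 := ENNReal.Tendsto.mul h1 (Or.inr (by simpa using hHtop))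
      ((ENNReal.Tendsto.mul h4 (Or.inr hHtop) h2 (Or.inr ENNReal.one_ne_top)).add h5)
      (Or.inr ENNReal.ofReal_ne_top)
    rw [one_mul, add_zero] at h6
    exact h6.eventually_lt_const (lt_of_le_of_lt (by gcongr) hJ'1)
  obtain ⟨ε, ⟨⟨⟨⟨hεB, hεC⟩, hεD⟩, hεL⟩, hε0⟩⟩ := ((((hXB.and (hlim C (1 / 2) (by norm_num))).and
    (hlim (D * C) (r / 2) (by positivity))).and hbound).and self_mem_nhdsWithin).exists
  have hε0 : 0 < ε := hε0
  set Λ := 1 + 2 * (ε * C) with hΛ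
  have hεC0 : 0 < ε * C := mul_pos hε0 hC0
  have hΛ1 : 1 ≤ Λ := by linarith
  set d' : Rn (m + 1) → ℝ := fun y => d (y + ε • X y) with hd'
  have hd's : ContDiff ℝ ∞ d' := hd.comp (contDiff_id.add (hXs.const_smul ε))
  have hmove : ∀ x ∈ closure A, x + ε • X x ∈ B := fun x hx => hεB x (closure_mono hAB hx)
  have hgrad : ∀ x ∈ closure A, d' x = 0 →
      ‖fderiv ℝ d' x‖ ≤ 1 + ε * C ∧ 1 - ε * C ≤ ‖fderiv ℝ d' x‖ := fun x hx h0 =>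
    norm_fderiv_comp_perturbation hXL hXd (hd.differentiable (by simp)) hε0.le
      (hd1 _ (hBK (hmove x hx)) h0)
  -- With `x = ε C`, one has `(1 + 2x)(1 - x) = 1 + x (1 - 2x) > 1`, so a single `Λ` controls the
  -- gradient from both sides.
  have hΛinv : Λ⁻¹ < 1 - ε * C := by
    rw [inv_lt_iff_one_lt_mul₀ (by linarith)]
    nlinarith
  -- The displacement carries zeros of `d'` in `closure A` to points of the interface in `B` at
  -- distance at most `ε C` from `A`. Its antilipschitz constant `Λ` transfers the area.
  have harea : μHE[m] (closure A ∩ {y | d' y = 0}) ≤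
      ENNReal.ofReal Λ ^ m *
        (μHE[m].restrict (frontier E ∩ B)) (Metric.cthickening (ε * C) A) := by
    refine (euclideanHausdorffMeasure_le_of_edist_le (K := Λ.toNNReal)
      (f := fun y => y + ε • X y) (fun x _ y _ => ?_) m).trans ?_
    · rw [edist_dist, edist_dist]
      change _ ≤ ENNReal.ofReal Λ * _
      rw [← ENNReal.ofReal_mul (by linarith)]
      exact ENNReal.ofReal_le_ofReal (dist_le_of_perturbation hXL hε0.le hεC.le x y)
    · change ENNReal.ofReal Λ ^ m * _ ≤ _
      rw [Measure.restrict_apply Metric.isClosed_cthickening.measurableSet]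
      gcongr
      rintro _ ⟨x, ⟨hxA, hx0⟩, rfl⟩
      refine ⟨?_, hdzero _ (hBK (hmove x hxA)) hx0, hmove x hxA⟩
      rw [← Metric.cthickening_closure]
      refine Metric.mem_cthickening_of_dist_le _ x _ _ hxA ?_
      change dist (x + ε • X x) x ≤ _
      rw [dist_eq_norm, add_sub_cancel_left, norm_smul, Real.norm_of_nonneg hε0.le]
      exact mul_le_mul_of_nonneg_left (hXC x) hε0.le
  have hclose : ∀ x ∈ A, |d' x - d x| ≤ r / 2 := by
    intro x hx
    have h1 := Convex.norm_image_sub_le_of_norm_fderiv_le (𝕜 := ℝ) (f := d) (C := D)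
      (s := Metric.closedBall (0 : Rn (m + 1)) R) (x := x) (y := x + ε • X x)
      (fun y _ => hd.differentiable (by simp) y) hD (convex_closedBall 0 R) (hR (hAK hx))
      (hR (hBK (hmove x (subset_closure hx))))
    rw [add_sub_cancel_left, norm_smul, Real.norm_of_nonneg hε0.le, Real.norm_eq_abs] at h1
    have hD0 : 0 ≤ D := (norm_nonneg _).trans (hD x (hR (hAK hx)))
    calc |d' x - d x| ≤ D * (ε * ‖X x‖) := h1
      _ ≤ D * (ε * C) := by gcongr; exact hXC x
      _ = ε * (D * C) := by ring
      _ ≤ r / 2 := hεD.le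
  have hfrA : ∀ᵐ x ∂volume.restrict A, x ∉ frontier E := by
    rw [ae_restrict_iff' hA.measurableSet, ae_iff]
    refine measure_mono_null (fun x hx => ?_) hnull
    simp only [mem_ofPred_eq, Classical.not_imp, not_not] at hx
    exact ⟨hx.2, hAK hx.1⟩
  filter_upwards [hP.eventually_energy_le hφ hη hd's hAb hΛ1
    (fun y hy h0 => lt_of_le_of_lt (hgrad y hy h0).1 (by linarith))
    (fun y hy h0 => lt_of_lt_of_le hΛinv (hgrad y hy h0).2) hε0
    (ENNReal.ofReal_pos.2 hε0).ne', hlim η (r / 2) (by positivity), self_mem_nhdsWithin]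
    with ν hνE hνr hν0
  have hν0 : 0 < ν := hν0
  have hcont : Continuous fun x => P (d' x / ν) :=
    hP.contDiff.continuous.comp (hd's.continuous.div_const ν)
  have hmem : MemLp (fun x => P (d' x / ν)) 2 (volume.restrict A) :=
    memLp_of_continuous_of_isBounded hcont hAb
  refine ⟨hmem.toLp _, hthin u _ ?_, ?_⟩
  · filter_upwards [hmem.coeFn_toLp, hu, hfrA, ae_restrict_mem hA.measurableSet] with x hx hux hxE hxA
    rw [hx, hux]
    have hxΩ : x ∈ Ω := hBΩ (hAB hxA)
    refine ⟨?_, fun hrx => ?_⟩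
    · refine (abs_sub _ _).trans (add_le_add (hcP _) ?_)
      by_cases hxm : x ∈ E ∩ Ω
      · rw [indicator_of_mem hxm]
      · rw [indicator_of_notMem hxm, abs_zero]; exact abs_nonneg s
    -- If `|d x| > r` then `d' x` has the same sign and modulus above `r / 2 > ν η`, so the
    -- transition is already complete. Off the null set `frontier E`, the sign of `d x` decides
    -- membership in `E`.
    · have hc := abs_le.1 (hclose x hxA)
      rcases lt_abs.1 hrx with h | h
      · have hxi : x ∈ interior (closure E) := (hdpos x (hAK hxA)).1 (hr.trans h)
        have hxE' : x ∈ E := by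
          by_contra hcon
          exact hxE ⟨interior_subset hxi, fun hi => hcon (interior_subset hi)⟩
        have hxm : x ∈ E ∩ Ω := ⟨hxE', hxΩ⟩
        rw [indicator_of_mem hxm]
        refine hP.right _ ((le_div_iff₀ hν0).2 ?_)
        linarith [hc.1]
      · have hxi : x ∈ interior (closure Eᶜ) := (hdneg x (hAK hxA)).1 (by linarith)
        have hxE' : x ∉ E := fun hcon => by
          have h2 := interior_subset hxi
          rw [closure_compl] at h2
          exact hxE ⟨subset_closure hcon, h2⟩
        have hxm : x ∉ E ∩ Ω := fun hcon => hxE' hcon.1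
        rw [indicator_of_notMem hxm]
        refine hP.left _ (div_nonpos_of_nonpos_of_nonneg ?_ hν0.le)
        linarith [hc.2]
  · refine (hνE _ hmem.coeFn_toLp).trans (le_trans ?_ hεL.le)
    gcongr

end PeronaMalik

/-! ### The two classes of sets `A` -/

theorem proposition5p5 {n : ℕ} (hn : 1 ≤ n)
    {φ : ℝ → ℝ} {a : ℝ} (hφ : PeronaMalik.IsAdmissible φ a)
    {Ω Ω' E' : Set (PeronaMalik.Rn n)}
    (hΩ : PeronaMalik.IsOpenLipschitz Ω)
    (hΩ'_open : IsOpen Ω') (hΩ'_bdd : Bornology.IsBounded Ω') (hΩΩ' : closure Ω ⊆ Ω')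
    (hE'_per : PeronaMalik.HasFinitePerimeterIn Ω' E')
    (hE'_smooth : PeronaMalik.IsSmoothHypersurfaceIn Ω' (frontier E'))
    (s : ℝ) {A : Set (PeronaMalik.Rn n)} (hA_open : IsOpen A) (hAΩ : A ⊆ Ω)
    -- `A` has Lipschitz boundary (for example `A = Ω`), or `∂A ∩ ∂E'` is negligible inside `Ω`
    (hA : PeronaMalik.IsOpenLipschitz A ∨ μHE[n - 1] (frontier A ∩ frontier E' ∩ Ω) = 0)
    -- `u` is the class of `s 1_E` in `L²(A)`, where `E = E' ∩ Ω`
    (u : MeasureTheory.Lp ℝ 2 (MeasureTheory.volume.restrict A))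
    (hu : u =ᵐ[MeasureTheory.volume.restrict A] (E' ∩ Ω).indicator (fun _ => s)) :
    PeronaMalik.gammaLimsup (PeronaMalik.energy φ A) u ≤
      PeronaMalik.sigma a * ENNReal.ofReal (|s| ^ ((2 + a) / (4 - a))) *
        μHE[n - 1] (A ∩ frontier (E' ∩ Ω)) := by
  obtain ⟨m, rfl⟩ : ∃ m, n = m + 1 := ⟨n - 1, by omega⟩
  rw [Nat.add_sub_cancel] at hA ⊢
  -- Inside the open set `Ω` the sets `E'` and `E' ∩ Ω` have the same frontier.
  have hfr : A ∩ frontier (E' ∩ Ω) = A ∩ frontier E' := by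
    have h := frontier_inter_open_inter (s := E') hΩ.1
    ext x
    refine and_congr_right fun hx => ?_
    have hxΩ := hAΩ hx
    have := congrArg (x ∈ ·) h
    simpa [hxΩ] using this
  rw [hfr]
  have hfrA : ∀ x ∈ closure A, x ∉ A → x ∈ frontier A := fun x hx hxA => by
    rw [hA_open.frontier_eq]; exact ⟨hx, hxA⟩
  -- A Lipschitz `A` is its own `B`, so only the interface inside `A` is counted. Otherwise `B = Ω`,
  -- and the extra part on `frontier A` is null by assumption.
  rcases hA with hA | hA
  · refine (PeronaMalik.gammaLimsup_energy_le hφ hΩ'_bdd hΩΩ' hE'_smooth hA hAΩ hA_open le_rfl s u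
      hu).trans ?_
    refine mul_le_mul_right (measure_mono ?_) _
    exact fun x hx => ⟨hx.2.2, hx.2.1⟩
  · refine (PeronaMalik.gammaLimsup_energy_le hφ hΩ'_bdd hΩΩ' hE'_smooth hΩ le_rfl hA_open hAΩ s u
      hu).trans ?_
    refine mul_le_mul_right ?_ _
    calc μHE[m] (closure A ∩ (frontier E' ∩ Ω)) ≤ μHE[m] (A ∩ frontier E' ∪ frontier A ∩ frontier E' ∩ Ω) := by
          refine measure_mono fun x hx => ?_
          by_cases hxA : x ∈ A
          · exact Or.inl ⟨hxA, hx.2.1⟩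
          · exact Or.inr ⟨⟨hfrA x hx.1 hxA, hx.2.1⟩, hx.2.2⟩
      _ ≤ μHE[m] (A ∩ frontier E') + μHE[m] (frontier A ∩ frontier E' ∩ Ω) := measure_union_le _ _
      _ = _ := by rw [hA, add_zero]
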